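/- All graphs are finite, simple and undirected. A segment is a straight line segment of non-zero length in the plane $\mathbb{R}^2$. A graph $G$ is a \emph{segment graph} if there is a map $f$ from $V(G)$ to the set of segments such that for all distinct $u,v\in V(G)$ we have $uv\in E(G)$ if and only if $f(u)\cap f(v)\neq\emptyset$. A graph is \emph{series-parallel} if, for some choice of two terminals $s,t$, it is a two-terminal series-parallel graph, that is, it can be built from single edges (whose terminals are their two ends) by repeated series compositions (identify the second terminal of one graph with the first terminal of another) and parallel compositions (identify first terminal with first terminal and second with second). A graph is \emph{outerplanar} if it can be drawn in the plane without crossings, with vertices as distinct points and edges as arcs, so that every vertex lies on the boundary of the unbounded face. \textbf{Corollary.} If $G$ is a series-parallel graph, then its complement $\overline{G}$ is a segment graph. If $G$ is an outerplanar graph, then its complement $\overline{G}$ is a segment graph. -/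

import Mathlib

/-- The Euclidean plane. -/
abbrev Plane : Type := EuclideanSpace ℝ (Fin 2)

/-- A straight line segment of non-zero length in the plane. -/
def IsLineSegment (S : Set Plane) : Prop :=
  ∃ a b : Plane, a ≠ b ∧ S = segment ℝ a b

/-- `A` is a (Jordan) arc with end-points `a` and `b`: the image of an injective continuous
map from the unit interval to the plane that takes `0` to `a` and `1` to `b`. -/
def IsArcBetween (A : Set Plane) (a b : Plane) : Prop :=
  ∃ γ : unitInterval → Plane,
    Continuous γ ∧ Function.Injective γ ∧ γ 0 = a ∧ γ 1 = b ∧ Set.range γ = A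

namespace SimpleGraph

/-- `G` is a segment graph: its vertices can be mapped to line segments in the plane so that
two distinct vertices are adjacent if and only if their segments intersect. -/
def IsSegmentGraph {V : Type*} (G : SimpleGraph V) : Prop :=
  ∃ f : V → Set Plane, (∀ v, IsLineSegment (f v)) ∧
    ∀ u v, u ≠ v → (G.Adj u v ↔ (f u ∩ f v).Nonempty)

/-- `IsTwoTerminalSP H s t`: the subgraph `H` of `G` is a two-terminal series-parallel graph
with terminals `s` and `t`, that is, it is built from single edges by series and parallel
compositions. A composition of two graphs that overlap in nothing but the identified terminals
is the union of two subgraphs that share exactly these vertices. (In a parallel composition in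
which both parts contain the edge `st`, the two parallel edges are merged.) -/
inductive IsTwoTerminalSP {V : Type*} {G : SimpleGraph V} : G.Subgraph → V → V → Prop
  | edge {s t : V} (h : G.Adj s t) : IsTwoTerminalSP (G.subgraphOfAdj h) s t
  | series {H K : G.Subgraph} {s m t : V}
      (hH : IsTwoTerminalSP H s m) (hK : IsTwoTerminalSP K m t)
      (hHK : H.verts ∩ K.verts = {m}) : IsTwoTerminalSP (H ⊔ K) s t
  | parallel {H K : G.Subgraph} {s t : V}
      (hH : IsTwoTerminalSP H s t) (hK : IsTwoTerminalSP K s t)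
      (hHK : H.verts ∩ K.verts = {s, t}) : IsTwoTerminalSP (H ⊔ K) s t

/-- `G` is series-parallel: for some choice of two terminals, the whole graph is a two-terminal
series-parallel graph. -/
def IsSeriesParallel {V : Type*} (G : SimpleGraph V) : Prop :=
  ∃ s t : V, IsTwoTerminalSP (⊤ : G.Subgraph) s t

/-- A drawing of `G` in the plane without crossings: the vertices are distinct points, every
edge is an arc that joins its two ends and contains no other vertex, and two distinct edges
meet at most in a common end. -/
structure PlaneDrawing {V : Type*} (G : SimpleGraph V) where
  /-- the point that represents a vertex -/
  point : V → Plane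
  /-- the arc that represents an edge (the values outside the edge set are irrelevant) -/
  arc : Sym2 V → Set Plane
  point_injective : Function.Injective point
  isArc : ∀ u v, G.Adj u v → IsArcBetween (arc s(u, v)) (point u) (point v)
  mem_of_point_mem_arc : ∀ e ∈ G.edgeSet, ∀ w, point w ∈ arc e → w ∈ e
  arc_inter_arc : ∀ e ∈ G.edgeSet, ∀ f ∈ G.edgeSet, e ≠ f →
    ∀ x ∈ arc e ∩ arc f, ∃ w, w ∈ e ∧ w ∈ f ∧ x = point w

/-- The set of all points of the plane that the drawing occupies. -/
def PlaneDrawing.carrier {V : Type*} {G : SimpleGraph V} (D : G.PlaneDrawing) : Set Plane :=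
  Set.range D.point ∪ ⋃ e ∈ G.edgeSet, D.arc e

/-- A face of the drawing: a connected component of the complement of the drawing. -/
def PlaneDrawing.IsFace {V : Type*} {G : SimpleGraph V} (D : G.PlaneDrawing)
    (F : Set Plane) : Prop :=
  ∃ x ∈ D.carrierᶜ, F = connectedComponentIn D.carrierᶜ x

/-- The outer face is the unbounded face; for a finite graph there is exactly one. -/
def PlaneDrawing.IsOuterFace {V : Type*} {G : SimpleGraph V} (D : G.PlaneDrawing)
    (F : Set Plane) : Prop :=
  D.IsFace F ∧ ¬ Bornology.IsBounded F

/-- `G` is outerplanar: it has a drawing in the plane without crossings in which every vertex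
lies on the boundary of the outer face. -/
def IsOuterplanar {V : Type*} (G : SimpleGraph V) : Prop :=
  ∃ (D : G.PlaneDrawing) (F : Set Plane), D.IsOuterFace F ∧ ∀ v, D.point v ∈ frontier F

end SimpleGraph

/-!
The complement of every subgraph `G` of a 2-tree is a segment graph, and both classes of graphs in
the theorem consist of subgraphs of 2-trees (up to the trivial graphs with at most one vertex).

*Two-trees to segments.* Two segments have to be disjoint exactly if their vertices are adjacent in
`G`, so almost all pairs have to cross. A 2-tree is built by attaching vertices `c` to edges, and a
representation is built along with it. For every edge of the 2-tree one end `a` and the other end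
`w`, it contains a placeholder: a segment that starts on `a`, passes an end (the tip) of `w`, and
crosses everything else properly (`IsArrangement`). A slight motion of the placeholder decides
whether it meets `w`, and a slight change of its length decides whether it meets `a`; hence a new
vertex `c` with prescribed adjacency to `a` and `w` can be placed next to it. The point is that
there is also room for new placeholders of the same kind for the three edges `aw`, `ac` (through
the tip of `c`) and `cw` (starting on `c`): this is `exists_split`, with coordinates in which the
old placeholder is the unit segment on the axis, and `IsArrangement.exists_insert` draws the
conclusion. Proper crossings are stable under small perturbations.

*Series-parallel graphs.* A two-terminal series-parallel graph can be glued to any 2-tree along an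
edge that joins the terminals (`IsTwoTerminalSP.extend_isTwoTree`).

*Outerplanar graphs.* A vertex in the outer face can be joined to all vertices such that edges
without a common end stay disjoint. The class `ConeDrawable` of graphs that allow this is closed
under minors, because edges with a common end are allowed to meet. It does not contain the complete
graph on four vertices: the complete graph on five vertices has no drawing with disjoint
independent edges. This is shown by counting, modulo two, the winding of the edges around the
vertices; the difference of two disjoint paths has a continuous logarithm on a square
(`windingChange_square`), and adding the resulting relations over all fifteen pairs of independent
edges gives a contradiction. Finally, Dirac's theorem that a graph without this minor has a vertex
of degree at most two (`ConeDrawable.support_eq_empty`) yields the 2-tree.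
-/

/-! ### Continuous logarithms and the complete graph on five vertices -/

/-- A continuous map from a simply connected space to the plane that avoids zero has a continuous
logarithm, and it is determined by its value at one point. -/
theorem existsUnique_continuous_log {A : Type*} [TopologicalSpace A] [SimplyConnectedSpace A]
    [LocallyPathConnectedSpace A] {f : A → ℂ} (hf : Continuous f) (h0 : ∀ x, f x ≠ 0) (a : A)
    {z : ℂ} (hz : Complex.exp z = f a) :
    ∃! L : C(A, ℂ), L a = z ∧ Complex.exp ∘ L = f :=
  Complex.isCoveringMapOn_exp.existsUnique_continuousMap_lifts ⟨f, hf⟩ hz (fun x => h0 x)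

open Classical in
/-- The change of a continuous logarithm of `f` between the parameters `0` and `1`. -/
noncomputable def logChange (f : ℝ → ℂ) : ℂ :=
  if h : ∃ L : C(ℝ, ℂ), Complex.exp ∘ L = f then h.choose 1 - h.choose 0 else 0

theorem logChange_eq {f : ℝ → ℂ} (L : C(ℝ, ℂ)) (hL : Complex.exp ∘ L = f) :
    logChange f = L 1 - L 0 := by
  have h : ∃ L : C(ℝ, ℂ), Complex.exp ∘ L = f := ⟨L, hL⟩
  have hM := h.choose_spec
  rw [logChange, dif_pos h]
  set M := h.choose
  have hf0 : ∀ x, f x ≠ 0 := fun x => by rw [← hL]; exact Complex.exp_ne_zero _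
  have hfc : Continuous f := by rw [← hL]; fun_prop
  have e : M = L + ContinuousMap.const ℝ (M 0 - L 0) := by
    refine (existsUnique_continuous_log hfc hf0 0 (z := M 0) (congrFun hM 0)).unique
      ⟨rfl, hM⟩ ⟨by simp, ?_⟩
    funext x
    have h1 : Complex.exp (M 0) = Complex.exp (L 0) := (congrFun hM 0).trans (congrFun hL 0).symm
    have h2 : Complex.exp (L x) = f x := congrFun hL x
    simp [Complex.exp_add, Complex.exp_sub, h1, h2]
  rw [e]
  simp only [ContinuousMap.add_apply, ContinuousMap.const_apply]
  ring

/-- The change of a logarithm of `f - z` along the path `f`. -/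
noncomputable def windingChange (f : ℝ → ℂ) (z : ℂ) : ℂ := logChange fun s => f s - z

theorem exp_windingChange {f : ℝ → ℂ} (hf : Continuous f) {z : ℂ} (h : ∀ s, f s ≠ z) :
    Complex.exp (windingChange f z) = (f 1 - z) / (f 0 - z) := by
  obtain ⟨L, ⟨-, hL⟩, -⟩ := existsUnique_continuous_log (f := fun s => f s - z) (by fun_prop)
    (fun s => sub_ne_zero.2 (h s)) 0 (Complex.exp_log (sub_ne_zero.2 (h 0)))
  rw [windingChange, logChange_eq L hL, Complex.exp_sub]
  have h0 : Complex.exp (L 0) = f 0 - z := congrFun hL 0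
  have h1 : Complex.exp (L 1) = f 1 - z := congrFun hL 1
  rw [h0, h1]

/-- For disjoint paths `f` and `g` the difference `f s - g t` has a continuous logarithm on the
whole square, so its changes along the four sides of the square cancel. -/
theorem windingChange_square {f g : ℝ → ℂ} (hf : Continuous f) (hg : Continuous g)
    (h : ∀ s t, f s ≠ g t) :
    windingChange f (g 0) - windingChange f (g 1) + windingChange g (f 1)
      - windingChange g (f 0) = 0 := by
  obtain ⟨L, ⟨-, hL⟩, -⟩ := existsUnique_continuous_log (A := ℝ × ℝ)
    (f := fun x => f x.1 - g x.2) (by fun_prop)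
    (fun x => sub_ne_zero.2 (h x.1 x.2)) 0 (Complex.exp_log (sub_ne_zero.2 (h 0 0)))
  have hL' : ∀ s t, Complex.exp (L (s, t)) = f s - g t := fun s t => congrFun hL (s, t)
  have h1 : ∀ t, windingChange f (g t) = L (1, t) - L (0, t) := fun t =>
    logChange_eq (L.comp ⟨fun s => (s, t), by fun_prop⟩) (funext fun s => hL' s t)
  have h2 : ∀ s, windingChange g (f s) = L (s, 1) - L (s, 0) := fun s => by
    have := logChange_eq (f := fun t => g t - f s)
      (L.comp ⟨fun t => (s, t), by fun_prop⟩ + ContinuousMap.const ℝ (Real.pi * Complex.I))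
      (funext fun t => by simp [Complex.exp_add, Complex.exp_pi_mul_I, hL'])
    simpa [windingChange] using this
  rw [h1, h1, h2, h2]
  ring

/-- A drawing of the complete graph on five vertices in the plane has two disjoint edges that
meet, even if the edges are arbitrary paths. -/
theorem not_disjoint_drawing_completeGraph_five (p : Fin 5 → ℂ) (γ : Fin 5 → Fin 5 → ℝ → ℂ)
    (hc : ∀ i j, Continuous (γ i j)) (h0 : ∀ i j, γ i j 0 = p i) (h1 : ∀ i j, γ i j 1 = p j)
    (hd : ∀ i j k l, i < j → k < l → i ≠ k → i ≠ l → j ≠ k → j ≠ l →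
      ∀ s t, γ i j s ≠ γ k l t) : False := by
  have hp : ∀ i j s k, i < j → k ≠ i → k ≠ j → γ i j s ≠ p k := by
    intro i j s k hij hki hkj
    obtain ⟨l, hl1, hl2, hl3⟩ : ∃ l : Fin 5, l ≠ i ∧ l ≠ j ∧ l ≠ k := by
      revert i j k; decide
    rcases lt_or_gt_of_ne hl3 with h | h
    · rw [← h1 l k]; exact hd i j l k hij h hl1.symm hki.symm hl2.symm hkj.symm s 1
    · rw [← h0 k l]; exact hd i j k l hij h hki.symm hl1.symm hkj.symm hl2.symm s 0
  have hpp : ∀ i j : Fin 5, i ≠ j → p i - p j ≠ 0 := by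
    intro i j hij
    obtain ⟨k, hk1, hk2⟩ : ∃ l : Fin 5, l ≠ i ∧ l ≠ j := by revert i j; decide
    rw [sub_ne_zero]
    rcases lt_or_gt_of_ne hk1 with h | h
    · rw [← h1 k i]; exact hp k i 1 j h hk2.symm hij.symm
    · rw [← h0 i k]; exact hp i k 0 j h hij.symm hk2.symm
  -- a logarithm of `p i - p j`, chosen so that swapping `i` and `j` changes it by `π I`
  let ℓ : Fin 5 → Fin 5 → ℂ := fun i j =>
    if i < j then Complex.log (p i - p j) else Complex.log (p j - p i) + Real.pi * Complex.I
  have hℓ : ∀ i j, i ≠ j → Complex.exp (ℓ i j) = p i - p j := by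
    intro i j hij
    by_cases h : i < j
    · simp only [ℓ, if_pos h, Complex.exp_log (hpp i j hij)]
    · simp [ℓ, if_neg h, Complex.exp_add, Complex.exp_log (hpp j i hij.symm),
        Complex.exp_pi_mul_I]
  have hex : ∀ i j k, ∃ n : ℤ, i < j → k ≠ i → k ≠ j →
      windingChange (γ i j) (p k) = ℓ j k - ℓ i k + n * (2 * Real.pi * Complex.I) := by
    intro i j k
    by_cases h : i < j ∧ k ≠ i ∧ k ≠ j
    · obtain ⟨hij, hki, hkj⟩ := h
      have := exp_windingChange (hc i j) (z := p k) (fun s => hp i j s k hij hki hkj)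
      rw [h0, h1, ← hℓ j k hkj.symm, ← hℓ i k hki.symm, ← Complex.exp_sub,
        Complex.exp_eq_exp_iff_exists_int] at this
      obtain ⟨n, hn⟩ := this
      exact ⟨n, fun _ _ _ => hn⟩
    · exact ⟨0, fun a b c => absurd ⟨a, b, c⟩ h⟩
  choose n hn using hex
  let σ : Fin 5 → Fin 5 → ℤ := fun i j => if i < j then 1 else 0
  have hσ : ∀ i j, i ≠ j → ℓ j i = ℓ i j + (2 * σ i j - 1) * (Real.pi * Complex.I) := by
    intro i j hij
    rcases lt_or_gt_of_ne hij with h | h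
    · simp only [ℓ, σ, if_pos h, if_neg h.not_gt]; push_cast; ring
    · simp only [ℓ, σ, if_pos h, if_neg h.not_gt]; push_cast; ring
  have key : ∀ i j k l, i < j → k < l → i ≠ k → i ≠ l → j ≠ k → j ≠ l →
      n i j k - n i j l + n k l j - n k l i + (σ j l - σ j k + σ i k - σ i l) = 0 := by
    intro i j k l hij hkl hik hil hjk hjl
    have e := windingChange_square (hc i j) (hc k l) (hd i j k l hij hkl hik hil hjk hjl)
    rw [h0, h1, h0, h1, hn i j k hij hik.symm hjk.symm, hn i j l hij hil.symm hjl.symm,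
      hn k l j hkl hjk hjl, hn k l i hkl hik hil, hσ j l hjl, hσ j k hjk, hσ i k hik,
      hσ i l hil] at e
    have hpi : (2 * Real.pi * Complex.I : ℂ) ≠ 0 := Complex.two_pi_I_ne_zero
    have e2 : ((n i j k - n i j l + n k l j - n k l i + (σ j l - σ j k + σ i k - σ i l) : ℤ) : ℂ)
        * (2 * Real.pi * Complex.I) = 0 := by
      push_cast
      rw [← e]
      ring
    rcases mul_eq_zero.1 e2 with h | h
    · exact_mod_cast h
    · exact absurd h hpi
  -- In the sum over all fifteen pairs of disjoint edges every `n` occurs an even number of times,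
  -- while an odd number of these pairs is interleaved.
  have a1 := key 0 1 2 3 (by decide) (by decide) (by decide) (by decide) (by decide) (by decide)
  have a2 := key 0 1 2 4 (by decide) (by decide) (by decide) (by decide) (by decide) (by decide)
  have a3 := key 0 1 3 4 (by decide) (by decide) (by decide) (by decide) (by decide) (by decide)
  have a4 := key 0 2 1 3 (by decide) (by decide) (by decide) (by decide) (by decide) (by decide)
  have a5 := key 0 2 1 4 (by decide) (by decide) (by decide) (by decide) (by decide) (by decide)
  have a6 := key 0 2 3 4 (by decide) (by decide) (by decide) (by decide) (by decide) (by decide)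
  have a7 := key 0 3 1 2 (by decide) (by decide) (by decide) (by decide) (by decide) (by decide)
  have a8 := key 0 3 1 4 (by decide) (by decide) (by decide) (by decide) (by decide) (by decide)
  have a9 := key 0 3 2 4 (by decide) (by decide) (by decide) (by decide) (by decide) (by decide)
  have b1 := key 0 4 1 2 (by decide) (by decide) (by decide) (by decide) (by decide) (by decide)
  have b2 := key 0 4 1 3 (by decide) (by decide) (by decide) (by decide) (by decide) (by decide)
  have b3 := key 0 4 2 3 (by decide) (by decide) (by decide) (by decide) (by decide) (by decide)
  have b4 := key 1 2 3 4 (by decide) (by decide) (by decide) (by decide) (by decide) (by decide)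
  have b5 := key 1 3 2 4 (by decide) (by decide) (by decide) (by decide) (by decide) (by decide)
  have b6 := key 1 4 2 3 (by decide) (by decide) (by decide) (by decide) (by decide) (by decide)
  simp +decide only [σ, if_true, if_false] at a1 a2 a3 a4 a5 a6 a7 a8 a9 b1 b2 b3 b4 b5 b6
  omega

/-- The complete graph on five vertices has no drawing in the plane in which disjoint edges are
represented by disjoint sets. -/
theorem not_disjoint_joinedIn_five (p : Fin 5 → Plane) (A : Fin 5 → Fin 5 → Set Plane)
    (hA : ∀ i j, i < j → JoinedIn (A i j) (p i) (p j))
    (hd : ∀ i j k l, i < j → k < l → i ≠ k → i ≠ l → j ≠ k → j ≠ l →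
      Disjoint (A i j) (A k l)) : False := by
  have hγ : ∀ i j, ∃ γ : Path (p i) (p j), i < j → ∀ t, γ t ∈ A i j := by
    intro i j
    by_cases h : i < j
    · exact ⟨(hA i j h).somePath, fun _ => (hA i j h).somePath_mem⟩
    · exact ⟨PathConnectedSpace.somePath _ _, fun h' => absurd h' h⟩
  choose γ hγ using hγ
  let e := Complex.orthonormalBasisOneI.repr.symm
  refine not_disjoint_drawing_completeGraph_five (fun i => e (p i))
    (fun i j s => e ((γ i j).extend s)) (fun i j => by fun_prop) (by simp) (by simp) ?_
  intro i j k l hij hkl hik hil hjk hjl s t h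
  have h := e.injective h
  have h1 : (γ i j).extend s ∈ A i j := hγ i j hij _
  have h2 : (γ k l).extend t ∈ A k l := hγ k l hkl _
  exact Set.disjoint_left.1 (hd i j k l hij hkl hik hil hjk hjl) h1 (h ▸ h2)

namespace SimpleGraph

variable {V : Type*}

/-! ### Minors and drawings of a cone -/

/-- Contraction of the edge `uv` into its end `v`, on the same vertex set: all edges at `u` are
moved to `v`, and `u` becomes isolated. -/
def contractInto (G : SimpleGraph V) (u v : V) : SimpleGraph V where
  Adj a b := a ≠ b ∧ a ≠ u ∧ b ≠ u ∧ (G.Adj a b ∨ a = v ∧ G.Adj u b ∨ b = v ∧ G.Adj u a)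
  symm := ⟨fun a b => by
    rintro ⟨h1, h2, h3, h⟩
    refine ⟨h1.symm, h3, h2, ?_⟩
    rcases h with h | h | h
    · exact .inl h.symm
    · exact .inr (.inr h)
    · exact .inr (.inl h)⟩
  loopless := ⟨fun a h => h.1 rfl⟩

/-- The cone over `G` (without its isolated vertices) can be drawn in the plane so that disjoint
edges are represented by disjoint path-connected sets; `x` represents the apex. Edges with a
common end may meet arbitrarily, which makes this property evidently closed under minors. -/
def ConeDrawable (G : SimpleGraph V) : Prop :=
  ∃ (pt : V → Plane) (x : Plane) (arc : V → V → Set Plane) (spoke : V → Set Plane),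
    (∀ u v, G.Adj u v → JoinedIn (arc u v) (pt u) (pt v)) ∧
    (∀ v ∈ G.support, JoinedIn (spoke v) x (pt v)) ∧
    (∀ a b c d, G.Adj a b → G.Adj c d → a ≠ c → a ≠ d → b ≠ c → b ≠ d →
      Disjoint (arc a b) (arc c d)) ∧
    (∀ w a b, w ∈ G.support → G.Adj a b → w ≠ a → w ≠ b → Disjoint (spoke w) (arc a b))

theorem ConeDrawable.mono {G H : SimpleGraph V} (hH : H.ConeDrawable) (h : G ≤ H) :
    G.ConeDrawable := by
  obtain ⟨pt, x, arc, spoke, h1, h2, h3, h4⟩ := hH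
  exact ⟨pt, x, arc, spoke, fun u v huv => h1 u v (h huv),
    fun v hv => h2 v (support_mono h hv),
    fun a b c d hab hcd => h3 a b c d (h hab) (h hcd),
    fun w a b hw hab => h4 w a b (support_mono h hw) (h hab)⟩

theorem ConeDrawable.contractInto {G : SimpleGraph V} (hG : G.ConeDrawable) {u v : V}
    (huv : G.Adj u v) : (G.contractInto u v).ConeDrawable := by
  classical
  obtain ⟨pt, x, arc, spoke, h1, h2, h3, h4⟩ := hG
  -- an edge that is moved from `u` to `v` is drawn along the edge `uv`
  let arc' : V → V → Set Plane := fun a b =>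
    if G.Adj a b then arc a b else if a = v then arc v u ∪ arc u b else arc a u ∪ arc u v
  have hsupp : ∀ w ∈ (G.contractInto u v).support, w ∈ G.support ∧ w ≠ u := by
    rintro w ⟨b, h, hu, hb, h' | ⟨rfl, h'⟩ | ⟨rfl, h'⟩⟩
    · exact ⟨⟨b, h'⟩, hu⟩
    · exact ⟨⟨u, huv.symm⟩, hu⟩
    · exact ⟨⟨u, h'.symm⟩, hu⟩
  -- every new arc lies in the arcs of edges whose ends are `u` or old ends
  have hsub : ∀ a b, (G.contractInto u v).Adj a b → ∀ y ∈ arc' a b, ∃ a' b', G.Adj a' b' ∧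
      y ∈ arc a' b' ∧ ((a' = a ∧ b' = b) ∨ ((a = v ∨ b = v) ∧
        (a' = u ∨ a' = a ∨ a' = b) ∧ (b' = u ∨ b' = a ∨ b' = b))) := by
    rintro a b ⟨hab, hau, hbu, h⟩ y hy
    by_cases hG : G.Adj a b
    · rw [show arc' a b = arc a b from if_pos hG] at hy
      exact ⟨a, b, hG, hy, .inl ⟨rfl, rfl⟩⟩
    · by_cases hav : a = v
      · subst hav
        rw [show arc' a b = arc a u ∪ arc u b from (if_neg hG).trans (if_pos rfl)] at hy
        have hub : G.Adj u b := by
          rcases h with h | ⟨-, h⟩ | ⟨h, -⟩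
          · exact absurd h hG
          · exact h
          · exact absurd h.symm hab
        rcases hy with hy | hy
        · exact ⟨a, u, huv.symm, hy, .inr ⟨.inl rfl, by simp, by simp⟩⟩
        · exact ⟨u, b, hub, hy, .inr ⟨.inl rfl, by simp, by simp⟩⟩
      · rw [show arc' a b = arc a u ∪ arc u v from (if_neg hG).trans (if_neg hav)] at hy
        obtain ⟨rfl, hua⟩ : b = v ∧ G.Adj u a := by
          rcases h with h | ⟨h, -⟩ | h
          · exact absurd h hG
          · exact absurd h hav
          · exact h
        rcases hy with hy | hy
        · exact ⟨a, u, hua.symm, hy, .inr ⟨.inr rfl, by simp, by simp⟩⟩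
        · exact ⟨u, b, huv, hy, .inr ⟨.inr rfl, by simp, by simp⟩⟩
  refine ⟨pt, x, arc', spoke, ?_, fun w hw => h2 w (hsupp w hw).1, ?_, ?_⟩
  · rintro a b ⟨hab, hau, hbu, h⟩
    by_cases hG : G.Adj a b
    · rw [show arc' a b = arc a b from if_pos hG]
      exact h1 a b hG
    · by_cases hav : a = v
      · subst hav
        rw [show arc' a b = arc a u ∪ arc u b from (if_neg hG).trans (if_pos rfl)]
        have hub : G.Adj u b := by
          rcases h with h | ⟨-, h⟩ | ⟨h, -⟩
          · exact absurd h hG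
          · exact h
          · exact absurd h.symm hab
        exact ((h1 a u huv.symm).mono Set.subset_union_left).trans
          ((h1 u b hub).mono Set.subset_union_right)
      · rw [show arc' a b = arc a u ∪ arc u v from (if_neg hG).trans (if_neg hav)]
        obtain ⟨rfl, hua⟩ : b = v ∧ G.Adj u a := by
          rcases h with h | ⟨h, -⟩ | h
          · exact absurd h hG
          · exact absurd h hav
          · exact h
        exact ((h1 a u hua.symm).mono Set.subset_union_left).trans
          ((h1 u b huv).mono Set.subset_union_right)
  · intro a b c d hab hcd hac had hbc hbd
    rw [Set.disjoint_left]
    intro y hy hy'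
    obtain ⟨a', b', hab', hya, ha'⟩ := hsub a b hab y hy
    obtain ⟨c', d', hcd', hyc, hc'⟩ := hsub c d hcd y hy'
    obtain ⟨-, hau, hbu, -⟩ := hab
    obtain ⟨-, hcu, hdu, -⟩ := hcd
    refine Set.disjoint_left.1 (h3 a' b' c' d' hab' hcd' ?_ ?_ ?_ ?_) hya hyc <;> grind
  · intro w a b hw hab hwa hwb
    rw [Set.disjoint_left]
    intro y hy hy'
    obtain ⟨a', b', hab', hya, ha'⟩ := hsub a b hab y hy'
    obtain ⟨hw1, hwu⟩ := hsupp w hw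
    refine Set.disjoint_left.1 (h4 w a' b' hw1 hab' ?_ ?_) hy hya <;> grind

theorem ConeDrawable.not_adj_four {G : SimpleGraph V} (hG : G.ConeDrawable) {a b c d : V}
    (hab : G.Adj a b) (hac : G.Adj a c) (had : G.Adj a d) (hbc : G.Adj b c) (hbd : G.Adj b d)
    (hcd : G.Adj c d) : False := by
  obtain ⟨pt, x, arc, spoke, h1, h2, h3, h4⟩ := hG
  let q : Fin 4 → V := ![a, b, c, d]
  have hq : ∀ i j, i < j → G.Adj (q i) (q j) := by
    intro i j hij
    fin_cases i <;> fin_cases j <;> simp_all [q]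
  have hq' : ∀ i j, i ≠ j → G.Adj (q i) (q j) := fun i j hij =>
    (lt_or_gt_of_ne hij).elim (hq i j) fun h => (hq j i h).symm
  have hs : ∀ i, q i ∈ G.support := fun i =>
    (exists_ne i).elim fun j hj => ⟨q j, hq' i j hj.symm⟩
  let A : Fin 5 → Fin 5 → Set Plane := Fin.cases (Fin.cases ∅ fun j => spoke (q j))
    fun i => Fin.cases ∅ fun j => arc (q i) (q j)
  refine not_disjoint_joinedIn_five (Fin.cases x fun i => pt (q i)) A ?_ ?_
  · refine Fin.cases (Fin.cases (by simp) fun j _ => h2 _ (hs j)) fun i => Fin.cases (by simp)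
      fun j hij => h1 _ _ (hq i j (Fin.succ_lt_succ_iff.1 hij))
  · refine Fin.cases (Fin.cases (by simp) fun j => Fin.cases (by simp) fun k =>
      Fin.cases (by simp) fun l _ hkl _ _ hjk hjl => ?_) fun i => Fin.cases (by simp) fun j =>
      Fin.cases (Fin.cases (by simp) fun l hij _ _ hil _ hjl => ?_) fun k => Fin.cases (by simp)
      fun l hij hkl hik hil hjk hjl => ?_
    · have hkl := hq k l (Fin.succ_lt_succ_iff.1 hkl)
      exact h4 _ _ _ (hs j) hkl (hq' j k (by simpa using hjk)).ne (hq' j l (by simpa using hjl)).ne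
    · have hij := hq i j (Fin.succ_lt_succ_iff.1 hij)
      exact (h4 _ _ _ (hs l) hij (hq' i l (by simpa using hil)).ne.symm
        (hq' j l (by simpa using hjl)).ne.symm).symm
    · exact h3 _ _ _ _ (hq i j (Fin.succ_lt_succ_iff.1 hij)) (hq k l (Fin.succ_lt_succ_iff.1 hkl))
        (hq' i k (by simpa using hik)).ne (hq' i l (by simpa using hil)).ne
        (hq' j k (by simpa using hjk)).ne (hq' j l (by simpa using hjl)).ne

/-! ### Outerplanar graphs -/

theorem PlaneDrawing.isCompact_arc {G : SimpleGraph V} (D : G.PlaneDrawing) {e : Sym2 V}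
    (he : e ∈ G.edgeSet) : IsCompact (D.arc e) := by
  induction e with
  | _ u v =>
    obtain ⟨γ, hγ, -, -, -, h⟩ := D.isArc u v he
    rw [← h]
    exact isCompact_range hγ

/-- In a drawing of a finite graph a point on the frontier of a face can be joined to the interior
of that face so that only the edges at this point are touched. Hence the vertices of an
outerplanar drawing can be joined to an additional vertex in the outer face. -/
theorem IsOuterplanar.coneDrawable [Finite V] {G : SimpleGraph V} (hG : G.IsOuterplanar) :
    G.ConeDrawable := by
  obtain ⟨D, F, ⟨⟨x, hx, hF⟩, -⟩, hv⟩ := hG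
  have hopen : IsOpen D.carrierᶜ := by
    refine (IsClosed.union (Set.finite_range _).isClosed ?_).isOpen_compl
    exact Set.Finite.isClosed_biUnion (Set.toFinite _) fun e he => (D.isCompact_arc he).isClosed
  have hFo : IsOpen F := hF ▸ hopen.connectedComponentIn
  have hFc : IsConnected F := hF ▸ isConnected_connectedComponentIn_iff.2 hx
  have hFp : IsPathConnected F := hFo.isConnected_iff_isPathConnected.1 hFc
  have hxF : x ∈ F := hF ▸ mem_connectedComponentIn hx
  have hFd : ∀ e ∈ G.edgeSet, Disjoint F (D.arc e) := by
    intro e he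
    rw [Set.disjoint_left]
    intro y hy hye
    rw [hF] at hy
    exact connectedComponentIn_subset _ _ hy (.inr (Set.mem_biUnion he hye))
  -- a ball around the point of `w` that misses all edges that are not at `w`
  have hball : ∀ w, ∃ ε > 0, ∀ e ∈ G.edgeSet, w ∉ e →
      Disjoint (Metric.ball (D.point w) ε) (D.arc e) := by
    intro w
    have hc : IsClosed (⋃ e ∈ {e | e ∈ G.edgeSet ∧ w ∉ e}, D.arc e) :=
      Set.Finite.isClosed_biUnion (Set.toFinite _) fun e he => (D.isCompact_arc he.1).isClosed
    have hw : D.point w ∈ (⋃ e ∈ {e | e ∈ G.edgeSet ∧ w ∉ e}, D.arc e)ᶜ := by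
      simp only [Set.mem_compl_iff, Set.mem_iUnion, not_exists]
      exact fun e he h => he.2 (D.mem_of_point_mem_arc e he.1 w h)
    obtain ⟨ε, hε, h⟩ := Metric.isOpen_iff.1 hc.isOpen_compl _ hw
    exact ⟨ε, hε, fun e he hwe => Set.disjoint_left.2 fun y hy hye =>
      h hy (Set.mem_biUnion (show e ∈ {e | e ∈ G.edgeSet ∧ w ∉ e} from ⟨he, hwe⟩) hye)⟩
  choose ε hε hball using hball
  refine ⟨D.point, x, fun a b => D.arc s(a, b), fun w => F ∪ Metric.ball (D.point w) (ε w),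
    ?_, ?_, ?_, ?_⟩
  · intro u v huv
    obtain ⟨γ, hγ, -, h0, h1, h⟩ := D.isArc u v huv
    exact ⟨⟨⟨γ, hγ⟩, h0, h1⟩, fun t => h.subset (Set.mem_range_self t)⟩
  · intro w _
    obtain ⟨y, hyb, hyF⟩ := mem_closure_iff.1 (frontier_subset_closure (hv w)) _
      Metric.isOpen_ball (Metric.mem_ball_self (hε w))
    exact ((hFp.joinedIn x hxF y hyF).mono Set.subset_union_left).trans
      ((((convex_ball (D.point w) (ε w)).isPathConnected ⟨y, hyb⟩).joinedIn y hyb _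
        (Metric.mem_ball_self (hε w))).mono Set.subset_union_right)
  · intro a b c d hab hcd hac had hbc hbd
    rw [Set.disjoint_left]
    intro y hy hy'
    obtain ⟨w, hw, hw', -⟩ := D.arc_inter_arc s(a, b) hab s(c, d) hcd
      (by simp [hac, had]) y ⟨hy, hy'⟩
    rw [Sym2.mem_iff] at hw hw'
    grind
  · intro w a b _ hab hwa hwb
    exact Set.disjoint_union_left.2 ⟨hFd _ hab, hball w _ hab (by simp [hwa, hwb])⟩

/-! ### Two-trees -/

/-- The 2-trees, given by their vertex set and edge set: an edge with its two ends is a 2-tree,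
and a new vertex may be joined to the two ends of an existing edge. -/
inductive IsTwoTree : Set V → Set (Sym2 V) → Prop
  | edge {a b : V} (hab : a ≠ b) : IsTwoTree {a, b} {s(a, b)}
  | insert {S : Set V} {E : Set (Sym2 V)} {a b c : V} (hS : IsTwoTree S E) (hab : s(a, b) ∈ E)
      (hc : c ∉ S) : IsTwoTree (insert c S) (insert s(a, c) (insert s(b, c) E))

theorem IsTwoTree.mem_of_mem {S : Set V} {E : Set (Sym2 V)} (h : IsTwoTree S E) :
    ∀ e ∈ E, ∀ v ∈ e, v ∈ S := by
  induction h with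
  | edge hab => simp
  | @insert S E a b c hS hab hc ih =>
    rintro e (rfl | rfl | he) v hv
    · rcases Sym2.mem_iff.1 hv with rfl | rfl
      · exact .inr (ih _ hab _ (Sym2.mem_mk_left _ _))
      · exact .inl rfl
    · rcases Sym2.mem_iff.1 hv with rfl | rfl
      · exact .inr (ih _ hab _ (Sym2.mem_mk_right _ _))
      · exact .inl rfl
    · exact .inr (ih e he v hv)

theorem IsTwoTree.exists_mem {S : Set V} {E : Set (Sym2 V)} (h : IsTwoTree S E) :
    ∀ a ∈ S, ∃ b, s(a, b) ∈ E := by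
  induction h with
  | @edge a b hab =>
    rintro x (rfl | rfl)
    · exact ⟨b, rfl⟩
    · exact ⟨a, Sym2.eq_swap⟩
  | @insert S E a b c hS hab hc ih =>
    rintro x (rfl | hx)
    · exact ⟨a, .inl Sym2.eq_swap⟩
    · exact (ih x hx).imp fun b hb => .inr (.inr hb)

/-! ### Series-parallel graphs -/

theorem IsTwoTerminalSP.mem_and_mem_and_ne {G : SimpleGraph V} {H : G.Subgraph} {s t : V}
    (h : IsTwoTerminalSP H s t) : s ∈ H.verts ∧ t ∈ H.verts ∧ s ≠ t := by
  induction h with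
  | edge h => exact ⟨by simp, by simp, h.ne⟩
  | @series H K s m t _ _ hHK ihH ihK =>
    refine ⟨.inl ihH.1, .inr ihK.2.1, ?_⟩
    rintro rfl
    have : s ∈ H.verts ∩ K.verts := ⟨ihH.1, ihK.2.1⟩
    rw [hHK] at this
    exact ihH.2.2 this
  | parallel _ _ _ ihH ihK => exact ⟨.inl ihH.1, .inl ihH.2.1, ihH.2.2⟩

/-- A 2-tree that meets a two-terminal series-parallel graph in the two terminals only, and has
them as an edge, extends to a 2-tree that contains this graph. -/
theorem IsTwoTerminalSP.extend_isTwoTree {G : SimpleGraph V} {H : G.Subgraph} {s t : V}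
    (h : IsTwoTerminalSP H s t) {S : Set V} {E : Set (Sym2 V)} (hS : IsTwoTree S E)
    (hst : s(s, t) ∈ E) (hHS : S ∩ H.verts = {s, t}) :
    ∃ E', IsTwoTree (S ∪ H.verts) E' ∧ E ⊆ E' ∧ H.edgeSet ⊆ E' := by
  induction h generalizing S E with
  | @edge s t h =>
    refine ⟨E, ?_, subset_rfl, by simpa using hst⟩
    have : S ∪ (G.subgraphOfAdj h).verts = S := by
      refine Set.union_eq_self_of_subset_right ?_
      rw [subgraphOfAdj_verts]
      rintro x (rfl | rfl)
      · exact hS.mem_of_mem _ hst _ (Sym2.mem_mk_left _ _)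
      · exact hS.mem_of_mem _ hst _ (Sym2.mem_mk_right _ _)
    rwa [this]
  | @series H K s m t hH hK hHK ihH ihK =>
    obtain ⟨hsH, hmH, hsm⟩ := hH.mem_and_mem_and_ne
    obtain ⟨hmK, htK, hmt⟩ := hK.mem_and_mem_and_ne
    have hverts : (H ⊔ K).verts = H.verts ∪ K.verts := rfl
    rw [hverts] at hHS
    have e1 : ∀ x, x ∈ S → x ∈ H.verts ∨ x ∈ K.verts → x = s ∨ x = t := fun x h1 h2 => by
      have : x ∈ S ∩ (H.verts ∪ K.verts) := ⟨h1, h2⟩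
      rwa [hHS] at this
    have e2 : ∀ x, x ∈ H.verts → x ∈ K.verts → x = m := fun x h1 h2 => by
      have : x ∈ H.verts ∩ K.verts := ⟨h1, h2⟩
      rwa [hHK] at this
    have hsS := hS.mem_of_mem _ hst _ (Sym2.mem_mk_left _ _)
    have htS := hS.mem_of_mem _ hst _ (Sym2.mem_mk_right _ _)
    have hmS : m ∉ S := fun h => by grind
    obtain ⟨E1, h1, h2, h3⟩ := ihH (hS.insert hst hmS) (.inl rfl) (by
      ext x; simp only [Set.mem_inter_iff, Set.mem_insert_iff, Set.mem_singleton_iff]; grind)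
    obtain ⟨E2, h4, h5, h6⟩ := ihK h1 (h2 (.inr (.inl Sym2.eq_swap))) (by
      ext x
      simp only [Set.mem_inter_iff, Set.mem_insert_iff, Set.mem_singleton_iff, Set.mem_union]
      grind)
    refine ⟨E2, ?_, fun e he => h5 (h2 (.inr (.inr he))), ?_⟩
    · convert h4 using 1
      ext x
      simp only [hverts, Set.mem_insert_iff, Set.mem_union]
      grind
    · rw [Subgraph.edgeSet_sup]
      exact Set.union_subset (h3.trans h5) h6
  | @parallel H K s t hH hK hHK ihH ihK =>
    obtain ⟨hsH, htH, hsm⟩ := hH.mem_and_mem_and_ne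
    obtain ⟨hsK, htK, -⟩ := hK.mem_and_mem_and_ne
    have hverts : (H ⊔ K).verts = H.verts ∪ K.verts := rfl
    rw [hverts] at hHS
    have e1 : ∀ x, x ∈ S → x ∈ H.verts ∨ x ∈ K.verts → x = s ∨ x = t := fun x h1 h2 => by
      have : x ∈ S ∩ (H.verts ∪ K.verts) := ⟨h1, h2⟩
      rwa [hHS] at this
    have e2 : ∀ x, x ∈ H.verts → x ∈ K.verts → x = s ∨ x = t := fun x h1 h2 => by
      have : x ∈ H.verts ∩ K.verts := ⟨h1, h2⟩
      rwa [hHK] at this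
    have hsS := hS.mem_of_mem _ hst _ (Sym2.mem_mk_left _ _)
    have htS := hS.mem_of_mem _ hst _ (Sym2.mem_mk_right _ _)
    obtain ⟨E1, h1, h2, h3⟩ := ihH hS hst (by
      ext x; simp only [Set.mem_inter_iff, Set.mem_insert_iff, Set.mem_singleton_iff]; grind)
    obtain ⟨E2, h4, h5, h6⟩ := ihK h1 (h2 hst) (by
      ext x
      simp only [Set.mem_inter_iff, Set.mem_insert_iff, Set.mem_singleton_iff, Set.mem_union]
      grind)
    refine ⟨E2, ?_, h2.trans h5, ?_⟩
    · rwa [hverts, ← Set.union_assoc]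
    · rw [Subgraph.edgeSet_sup]
      exact Set.union_subset (h3.trans h5) h6

theorem IsSeriesParallel.exists_isTwoTree {G : SimpleGraph V} (hG : G.IsSeriesParallel) :
    ∃ E, IsTwoTree Set.univ E ∧ G.edgeSet ⊆ E := by
  obtain ⟨s, t, h⟩ := hG
  obtain ⟨E, h1, -, h2⟩ := h.extend_isTwoTree (IsTwoTree.edge h.mem_and_mem_and_ne.2.2) rfl
    (by simp)
  exact ⟨E, by simpa using h1, by simpa using h2⟩

/-! ### Graphs without the complete graph on four vertices as a minor -/

theorem support_contractInto_subset {G : SimpleGraph V} {u v : V} (huv : G.Adj u v) :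
    (G.contractInto u v).support ⊆ G.support \ {u} := by
  rintro w ⟨b, h, hu, hb, h' | ⟨rfl, h'⟩ | ⟨rfl, h'⟩⟩
  · exact ⟨⟨b, h'⟩, hu⟩
  · exact ⟨⟨u, huv.symm⟩, hu⟩
  · exact ⟨⟨u, h'.symm⟩, hu⟩

theorem ncard_support_contractInto_lt [Finite V] {G : SimpleGraph V} {u v : V}
    (huv : G.Adj u v) : (G.contractInto u v).support.ncard < G.support.ncard :=
  Set.ncard_lt_ncard ⟨(support_contractInto_subset huv).trans Set.sdiff_subset,
    fun h => (support_contractInto_subset huv (h ⟨v, huv⟩)).2 rfl⟩ (Set.toFinite _)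

/-- If `N` keeps its elements, except that `u` may be replaced by `r`, and `u` and `r` are not
both in `N`, then it does not lose cardinality. -/
theorem le_ncard_of_replace [Finite V] {N N' : Set V} {k : ℕ} (hk : k ≤ N.ncard) (u r : V)
    (h : ∀ y ∈ N, y ≠ u → y ∈ N') (hu : u ∈ N → r ∈ N') (hur : u ∈ N → r ∉ N) :
    k ≤ N'.ncard := by
  classical
  refine hk.trans (Set.ncard_le_ncard_of_injOn (fun y => if y = u then r else y) ?_ ?_
    (Set.toFinite _))
  · intro y hy
    split_ifs with hyu
    · exact hu (hyu ▸ hy)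
    · exact h y hy hyu
  · intro y hy z hz hyz
    dsimp only at hyz
    split_ifs at hyz <;> grind

theorem three_le_ncard_neighborSet_contractInto [Finite V] {G : SimpleGraph V} {u r v : V}
    (hvu : v ≠ u) (hvr : v ≠ r) (hur : u ≠ r) (h : 3 ≤ (G.neighborSet v).ncard)
    (h' : G.Adj v u → G.Adj v r → (G.neighborSet v).ncard ≠ 3) :
    3 ≤ ((G.contractInto u r).neighborSet v).ncard := by
  by_cases hb : G.Adj v u ∧ G.Adj v r
  · have h3 := h' hb.1 hb.2
    have : (G.neighborSet v \ {u}) ⊆ (G.contractInto u r).neighborSet v := fun y hy =>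
      ⟨G.ne_of_adj hy.1, hvu, hy.2, .inl hy.1⟩
    refine le_trans ?_ (Set.ncard_le_ncard this (Set.toFinite _))
    rw [Set.ncard_sdiff_singleton_of_mem (show u ∈ G.neighborSet v from hb.1)]
    omega
  · refine le_ncard_of_replace h u r (fun y hy hyu => ?_) (fun hu => ?_)
      (fun hu hr => hb ⟨hu, hr⟩)
    · exact ⟨G.ne_of_adj hy, hvu, hyu, .inl hy⟩
    · exact ⟨hvr, hvu, hur.symm, .inr (.inr ⟨rfl, G.adj_symm hu⟩)⟩

theorem exists_neighborSet_eq_three [Finite V] {G : SimpleGraph V} {w a b : V}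
    (h : (G.neighborSet w).ncard = 3) (ha : G.Adj w a) (hb : G.Adj w b) (hab : a ≠ b) :
    ∃ c, c ≠ a ∧ c ≠ b ∧ G.Adj w c ∧ ∀ y, G.Adj w y → y = a ∨ y = b ∨ y = c := by
  obtain ⟨c, hc, hc'⟩ := Set.exists_mem_notMem_of_ncard_lt_ncard
    (s := {a, b}) (t := G.neighborSet w) (by rw [h, Set.ncard_pair hab]; omega)
  have hc' : c ≠ a ∧ c ≠ b := by simpa using hc'
  have hsub : ({a, b, c} : Set V) ⊆ G.neighborSet w := by
    rintro y (rfl | rfl | rfl) <;> assumption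
  have e := Set.eq_of_subset_of_ncard_le hsub (by
    rw [h, Set.ncard_eq_three.2 ⟨a, b, c, hab, hc'.1.symm, hc'.2.symm, rfl⟩]) (Set.toFinite _)
  refine ⟨c, hc'.1, hc'.2, hc, fun y hy => ?_⟩
  have : y ∈ ({a, b, c} : Set V) := by rw [e]; exact hy
  exact this

/-- Dirac's theorem for the minor-closed class `ConeDrawable`, which does not contain the complete
graph on four vertices: a graph in this class cannot have degree at least three at all
non-isolated vertices; not even if one vertex `r` is exempt, which makes an induction by
contraction of edges at `r` possible. Such a contraction fails only if some common neighbour of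
the two ends has degree exactly three. -/
theorem ConeDrawable.support_eq_empty [Finite V] {G : SimpleGraph V} (hG : G.ConeDrawable)
    (r : V) (hr : ∀ v ∈ G.support, v ≠ r → 3 ≤ (G.neighborSet v).ncard) :
    G.support = ∅ := by
  induction hn : G.support.ncard using Nat.strong_induction_on generalizing G r with
  | _ n ih =>
  subst hn
  by_contra hne
  obtain ⟨r', hr', hdeg⟩ :
      ∃ r' ∈ G.support, ∀ v ∈ G.support, v ≠ r' → 3 ≤ (G.neighborSet v).ncard := by
    by_cases h : r ∈ G.support
    · exact ⟨r, h, hr⟩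
    · obtain ⟨r', hr'⟩ := Set.nonempty_iff_ne_empty.2 hne
      exact ⟨r', hr', fun v hv _ => hr v hv (by rintro rfl; exact h hv)⟩
  clear hne hr r
  rename' r' => r, hr' => hr
  have hdeg' : ∀ v y, G.Adj v y → v ≠ r → 3 ≤ (G.neighborSet v).ncard :=
    fun v y h => hdeg v ⟨y, h⟩
  have hcommon : ∀ u, G.Adj r u →
      ∃ w, G.Adj w r ∧ G.Adj w u ∧ (G.neighborSet w).ncard = 3 := by
    intro u hru
    by_contra! hno
    have hem := ih _ (ncard_support_contractInto_lt hru.symm) (hG.contractInto hru.symm) r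
      (fun v hv hvr => by
        obtain ⟨hv1, hv2⟩ := support_contractInto_subset hru.symm hv
        exact three_le_ncard_neighborSet_contractInto hv2 hvr hru.ne' (hdeg v hv1 hvr)
          fun h1 h2 => hno v h2 h1) rfl
    obtain ⟨y, hy, hyr⟩ := Set.exists_mem_notMem_of_ncard_lt_ncard
      (s := {r}) (t := G.neighborSet u) (by
        have := hdeg' u r hru.symm hru.ne'
        rw [Set.ncard_singleton]; omega)
    have hyr : y ≠ r := hyr
    have : (G.contractInto u r).Adj r y :=
      ⟨hyr.symm, hru.ne, (G.ne_of_adj hy).symm, .inr (.inl ⟨rfl, hy⟩)⟩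
    exact Set.notMem_empty r (hem ▸ ⟨y, this⟩)
  obtain ⟨u, hru⟩ := hr
  obtain ⟨w, hwr, -, hw3⟩ := hcommon u hru
  obtain ⟨x, hxr, hxw, hx3⟩ := hcommon w hwr.symm
  obtain ⟨z, hzr, hzx, hwz, hNw⟩ := exists_neighborSet_eq_three hw3 hwr hxw.symm hxr.ne'
  obtain ⟨t, htr, htw, hxt, hNx⟩ := exists_neighborSet_eq_three hx3 hxr hxw hwr.ne'
  by_cases hzt : z = t
  · subst hzt
    by_cases hrz : G.Adj r z
    · exact hG.not_adj_four hwr.symm hxr.symm hrz hxw.symm hwz hxt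
    by_cases hy : ∃ y, y ≠ w ∧ y ≠ x ∧ G.Adj z y ∧ G.Adj y r
    · obtain ⟨y, hyw, hyx, hzy, hyr⟩ := hy
      have hyz := hzy.ne'
      refine (hG.contractInto hyr).not_adj_four (a := r) (b := w) (c := x) (d := z)
        ⟨hwr.ne', hyr.ne', hyw.symm, .inl hwr.symm⟩ ⟨hxr.ne', hyr.ne', hyx.symm, .inl hxr.symm⟩
        ⟨hzr.symm, hyr.ne', hyz.symm, .inr (.inl ⟨rfl, hzy.symm⟩)⟩
        ⟨hxw.ne', hyw.symm, hyx.symm, .inl hxw.symm⟩ ⟨hwz.ne, hyw.symm, hyz.symm, .inl hwz⟩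
        ⟨hxt.ne, hyx.symm, hyz.symm, .inl hxt⟩
    push Not at hy
    rename' hy => hzN
    -- contraction of `w`, `x` and `z` into `r`, with the neighbours of `r` that matter
    let H : SimpleGraph V :=
      { Adj := fun a b => a ≠ b ∧ (a ≠ w ∧ a ≠ x ∧ a ≠ z) ∧ (b ≠ w ∧ b ≠ x ∧ b ≠ z) ∧
          (G.Adj a b ∨ a = r ∧ G.Adj z b ∨ b = r ∧ G.Adj z a)
        symm := ⟨fun a b => by
          rintro ⟨h1, h2, h3, h⟩
          refine ⟨h1.symm, h3, h2, ?_⟩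
          rcases h with h | h | h
          · exact .inl h.symm
          · exact .inr (.inr h)
          · exact .inr (.inl h)⟩
        loopless := ⟨fun a h => h.1 rfl⟩ }
    have hzr' : (G.contractInto w r).Adj z r :=
      ⟨hzr, hwz.ne', hwr.ne', .inr (.inr ⟨rfl, hwz⟩)⟩
    have hH : H ≤ (G.contractInto w r).contractInto z r := by
      rintro a b ⟨hab, ⟨haw, hax, haz⟩, ⟨hbw, hbx, hbz⟩, h⟩
      refine ⟨hab, haz, hbz, ?_⟩
      rcases h with h | ⟨h1, h⟩ | ⟨h1, h⟩
      · exact .inl ⟨hab, haw, hbw, .inl h⟩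
      · exact .inr (.inl ⟨h1, hbz.symm, hwz.ne', hbw, .inl h⟩)
      · exact .inr (.inr ⟨h1, haz.symm, hwz.ne', haw, .inl h⟩)
    have hsupp : ∀ v ∈ H.support, v ∈ G.support ∧ v ≠ w ∧ v ≠ x ∧ v ≠ z := by
      rintro v ⟨b, hab, hv, hb, h⟩
      refine ⟨?_, hv⟩
      rcases h with h | ⟨rfl, h⟩ | ⟨-, h⟩
      · exact ⟨b, h⟩
      · exact ⟨w, hwr.symm⟩
      · exact ⟨z, h.symm⟩
    have hlt : H.support.ncard < G.support.ncard := Set.ncard_lt_ncard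
      ⟨fun v hv => (hsupp v hv).1, fun h => (hsupp z (h ⟨w, hwz.symm⟩)).2.2.2 rfl⟩ (Set.toFinite _)
    have hem := ih _ hlt (((hG.contractInto hwr).contractInto hzr').mono hH) r (fun v hv hvr => by
      obtain ⟨hv1, hvw, hvx, hvz⟩ := hsupp v hv
      have hvw' : ¬ G.Adj v w := fun h => by have := hNw v h.symm; grind
      have hvx' : ¬ G.Adj v x := fun h => by have := hNx v h.symm; grind
      refine le_ncard_of_replace (hdeg v hv1 hvr) z r (fun y hy hyz => ?_) (fun hz => ?_)
        (fun hz hr => hzN v hvw hvx (G.adj_symm hz) hr)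
      · exact ⟨G.ne_of_adj hy, ⟨hvw, hvx, hvz⟩,
          ⟨fun h => hvw' (h ▸ hy), fun h => hvx' (h ▸ hy), hyz⟩, .inl hy⟩
      · exact ⟨hvr, ⟨hvw, hvx, hvz⟩, ⟨hwr.ne', hxr.ne', hzr.symm⟩,
          .inr (.inr ⟨rfl, G.adj_symm hz⟩)⟩) rfl
    obtain ⟨y, hzy, hy'⟩ := Set.exists_mem_notMem_of_ncard_lt_ncard
      (s := {w, x}) (t := G.neighborSet z) (by
        have := hdeg' z w hwz.symm hzr
        rw [Set.ncard_pair hxw.ne']; omega)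
    have hy' : y ≠ w ∧ y ≠ x := by simpa using hy'
    have hyr : y ≠ r := by rintro rfl; exact hrz (G.adj_symm hzy)
    have : H.Adj r y := ⟨hyr.symm, ⟨hwr.ne', hxr.ne', hzr.symm⟩,
      ⟨hy'.1, hy'.2, (G.ne_of_adj hzy).symm⟩, .inr (.inl ⟨rfl, hzy⟩)⟩
    exact Set.notMem_empty r (hem ▸ ⟨y, this⟩)
  · have hadj : ∀ y, y ≠ x → y ≠ w → (G.Adj w y ∨ G.Adj x y) → (G.contractInto x w).Adj w y := by
      rintro y hyx hyw (h | h)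
      · exact ⟨hyw.symm, hxw.ne', hyx, .inl h⟩
      · exact ⟨hyw.symm, hxw.ne', hyx, .inr (.inl ⟨rfl, h⟩)⟩
    have hem := ih _ (ncard_support_contractInto_lt hxw) (hG.contractInto hxw) r
      (fun v hv hvr => by
        obtain ⟨hv1, hv2⟩ := support_contractInto_subset hxw hv
        by_cases hvw : v = w
        · subst hvw
          have hsub : ({r, z, t} : Set V) ⊆ (G.contractInto x v).neighborSet v := by
            rintro y (rfl | rfl | rfl)
            · exact hadj y hxr.ne' hvr.symm (.inl hwr)
            · exact hadj y hzx hwz.ne' (.inl hwz)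
            · exact hadj y hxt.ne' htw (.inr hxt)
          rw [← Set.ncard_eq_three.2 ⟨r, z, t, hzr.symm, htr.symm, hzt, rfl⟩]
          exact Set.ncard_le_ncard hsub (Set.toFinite _)
        · refine three_le_ncard_neighborSet_contractInto hv2 hvw hxw.ne (hdeg v hv1 hvr)
            fun h1 h2 => ?_
          have := hNx v h1.symm
          have := hNw v h2.symm
          grind) rfl
    exact Set.notMem_empty w (hem ▸ ⟨r, hadj r hxr.ne' hwr.ne' (.inl hwr)⟩)

/-- By Dirac's theorem there is a vertex of degree at most two; it is removed, after contracting
one of its edges in case it has two neighbours. -/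
theorem ConeDrawable.exists_isTwoTree [Finite V] {G : SimpleGraph V} (hG : G.ConeDrawable)
    {S : Set V} (hS : 2 ≤ S.ncard) (hGS : G.support ⊆ S) :
    ∃ E, IsTwoTree S E ∧ G.edgeSet ⊆ E := by
  obtain ⟨n, hn⟩ := Nat.exists_eq_add_of_le' hS
  clear hS
  induction n generalizing G S with
  | zero =>
    obtain ⟨a, b, hab, rfl⟩ := Set.ncard_eq_two.1 hn
    refine ⟨_, .edge hab, fun e => ?_⟩
    induction e with
    | _ x y =>
      intro h
      have h : G.Adj x y := h
      have hx := hGS ⟨y, h⟩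
      have hy := hGS ⟨x, h.symm⟩
      have := h.ne
      simp only [Set.mem_insert_iff, Set.mem_singleton_iff, Sym2.eq_iff] at hx hy ⊢
      grind
  | succ n ih =>
    obtain ⟨v, hvS, hv⟩ : ∃ v ∈ S, (G.neighborSet v).ncard ≤ 2 := by
      by_contra! h
      obtain ⟨r, hr⟩ : S.Nonempty := Set.nonempty_of_ncard_ne_zero (by omega)
      have hem := hG.support_eq_empty r fun v hv _ => h v (hGS hv)
      have h0 : G.neighborSet r = ∅ := Set.eq_empty_of_forall_notMem fun y hy =>
        Set.notMem_empty r (hem ▸ ⟨y, hy⟩)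
      have := h r hr
      rw [h0, Set.ncard_empty] at this
      omega
    have hcard : (S \ {v}).ncard = n + 2 := by
      rw [Set.ncard_sdiff_singleton_of_mem hvS]; omega
    suffices h : ∃ E a b, IsTwoTree (S \ {v}) E ∧ s(a, b) ∈ E ∧
        (∀ y, G.Adj v y → y = a ∨ y = b) ∧ ∀ x y, x ≠ v → y ≠ v → G.Adj x y → s(x, y) ∈ E by
      obtain ⟨E, a, b, hE, hab, hN, hGE⟩ := h
      refine ⟨_, by simpa [Set.insert_eq_of_mem hvS] using hE.insert (c := v) hab (by simp),
        fun e => ?_⟩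
      induction e with
      | _ x y =>
        intro h
        have h : G.Adj x y := h
        by_cases hx : x = v
        · subst hx
          rcases hN y h with rfl | rfl
          · exact .inl Sym2.eq_swap
          · exact .inr (.inl Sym2.eq_swap)
        by_cases hy : y = v
        · subst hy
          rcases hN x h.symm with rfl | rfl
          · exact .inl rfl
          · exact .inr (.inl rfl)
        exact .inr (.inr (hGE x y hx hy h))
    by_cases h2 : (G.neighborSet v).ncard = 2
    · obtain ⟨a, b, hab, hN⟩ := Set.ncard_eq_two.1 h2
      have ha : G.Adj v a := show a ∈ G.neighborSet v by simp [hN]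
      have hb : G.Adj v b := show b ∈ G.neighborSet v by simp [hN]
      obtain ⟨E, hE, hGE⟩ := ih (hG.contractInto ha)
        ((support_contractInto_subset ha).trans (Set.sdiff_subset_sdiff_left hGS)) hcard
      refine ⟨E, a, b, hE, hGE (show (G.contractInto v a).Adj a b from
        ⟨hab, ha.ne', hb.ne', .inr (.inl ⟨rfl, hb⟩)⟩), fun y hy => ?_, fun x y hx hy h =>
        hGE (show (G.contractInto v a).Adj x y from ⟨h.ne, hx, hy, .inl h⟩)⟩
      have : y ∈ G.neighborSet v := hy
      simpa [hN] using this
    · obtain ⟨a, haS, hN⟩ : ∃ a ∈ S \ {v}, ∀ y, G.Adj v y → y = a := by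
        rcases (G.neighborSet v).eq_empty_or_nonempty with h0 | ⟨a, ha⟩
        · obtain ⟨a, ha⟩ : (S \ {v}).Nonempty := Set.nonempty_of_ncard_ne_zero (by omega)
          exact ⟨a, ha, fun y hy => absurd (show y ∈ G.neighborSet v from hy) (by simp [h0])⟩
        · refine ⟨a, ⟨hGS ⟨v, G.adj_symm ha⟩, (G.ne_of_adj ha).symm⟩, fun y hy => ?_⟩
          exact (Set.ncard_le_one_iff (Set.toFinite _)).1 (by omega : (G.neighborSet v).ncard ≤ 1) hy ha
      obtain ⟨E, hE, hGE⟩ := ih (hG.mono (G.deleteIncidenceSet_le v)) (S := S \ {v}) (by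
        rintro x ⟨y, hxy⟩
        have hxy := deleteIncidenceSet_adj.1 hxy
        exact ⟨hGS ⟨y, hxy.1⟩, hxy.2.1⟩) hcard
      obtain ⟨b, hb⟩ := hE.exists_mem a haS
      exact ⟨E, a, b, hE, hb, fun y hy => .inl (hN y hy), fun x y hx hy h =>
        hGE (show (G.deleteIncidenceSet v).Adj x y from deleteIncidenceSet_adj.2 ⟨h, hx, hy⟩)⟩

end SimpleGraph

open Filter Topology

/-! ### Crossing segments -/

/-- Twice the signed area of the triangle `pqr`; it vanishes if and only if the points are
collinear. -/
def orient (p q r : ℝ × ℝ) : ℝ :=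
  (q.1 - p.1) * (r.2 - p.2) - (q.2 - p.2) * (r.1 - p.1)

/-- The segments `pq` and `rs` cross properly: the ends of each of them lie strictly on different
sides of the line through the other. This is an open condition. -/
def Crosses (p q r s : ℝ × ℝ) : Prop :=
  orient p q r * orient p q s < 0 ∧ orient r s p * orient r s q < 0

/-- The segments `pq` and `rs` have a common point. -/
def Meets (p q r s : ℝ × ℝ) : Prop :=
  (segment ℝ p q ∩ segment ℝ r s).Nonempty

/-- The segment `AB` starts in a relatively interior point `A` of the segment `pq`, transversally
to it. -/
def StartsOn (A B p q : ℝ × ℝ) : Prop :=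
  orient p q A = 0 ∧ orient A B p * orient A B q < 0

/-- The segment `AB` passes through the end `p` of the segment `pq`, transversally to it. -/
def PassesTip (A B p q : ℝ × ℝ) : Prop :=
  orient A B p = 0 ∧ orient A B q ≠ 0 ∧ orient p q A * orient p q B < 0

theorem Crosses.symm {p q r s : ℝ × ℝ} (h : Crosses p q r s) : Crosses r s p q := ⟨h.2, h.1⟩

theorem Meets.symm {p q r s : ℝ × ℝ} (h : Meets p q r s) : Meets r s p q := by
  rwa [Meets, Set.inter_comm]

theorem meets_comm {p q r s : ℝ × ℝ} : Meets p q r s ↔ Meets r s p q := ⟨.symm, .symm⟩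

theorem Crosses.meets {p q r s : ℝ × ℝ} (h : Crosses p q r s) : Meets p q r s := by
  obtain ⟨h1, h2⟩ := h
  have key : ∀ x y : ℝ, x * y < 0 → x - y ≠ 0 ∧ 0 ≤ x / (x - y) ∧ x / (x - y) ≤ 1 := by
    intro x y hxy
    rcases mul_neg_iff.1 hxy with ⟨hx, hy⟩ | ⟨hx, hy⟩
    · have : 0 < x - y := by linarith
      exact ⟨this.ne', by positivity, (div_le_one this).2 (by linarith)⟩
    · have : x - y < 0 := by linarith
      exact ⟨this.ne, div_nonneg_of_nonpos hx.le this.le,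
        (div_le_one_of_neg this).2 (by linarith)⟩
  obtain ⟨e1, t0, t1⟩ := key _ _ h1
  obtain ⟨e2, u0, u1⟩ := key _ _ h2
  set u := orient r s p / (orient r s p - orient r s q) with hu
  set t := orient p q r / (orient p q r - orient p q s) with ht
  refine ⟨(1 - u) • p + u • q, ⟨1 - u, u, by linarith, u0, by ring, rfl⟩,
    ⟨1 - t, t, by linarith, t0, by ring, ?_⟩⟩
  have hu' : u * (orient r s p - orient r s q) = orient r s p := div_mul_cancel₀ _ e2
  have ht' : t * (orient p q r - orient p q s) = orient p q r := div_mul_cancel₀ _ e1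
  have hD : orient r s p - orient r s q = -(orient p q r - orient p q s) := by
    simp only [orient]; ring
  simp only [orient] at hu' ht' hD e1
  refine Prod.ext ?_ ?_
  · refine mul_right_cancel₀ e1 ?_
    simp only [Prod.fst_add, Prod.smul_fst, smul_eq_mul]
    linear_combination (s.1 - r.1) * ht' + (q.1 - p.1) * hu' - u * (q.1 - p.1) * hD
  · refine mul_right_cancel₀ e1 ?_
    simp only [Prod.snd_add, Prod.smul_snd, smul_eq_mul]
    linear_combination (s.2 - r.2) * ht' + (q.2 - p.2) * hu' - u * (q.2 - p.2) * hD

theorem orient_convexComb (p q r s : ℝ × ℝ) {a b : ℝ} (hab : a + b = 1) :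
    orient p q (a • r + b • s) = a * orient p q r + b * orient p q s := by
  obtain rfl : a = 1 - b := by linarith
  simp only [orient, Prod.fst_add, Prod.snd_add, Prod.smul_fst, Prod.smul_snd, smul_eq_mul]
  ring

theorem not_meets_of_orient_mul_pos {p q r s : ℝ × ℝ} (h : 0 < orient p q r * orient p q s) :
    ¬ Meets p q r s := by
  rintro ⟨z, ⟨a, b, ha, hb, hab, rfl⟩, ⟨a', b', ha', hb', hab', e⟩⟩
  have h1 := orient_convexComb p q p q hab
  have h2 := orient_convexComb p q r s hab'
  have hp : orient p q p = 0 := by simp [orient]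
  have hq : orient p q q = 0 := by simp only [orient]; ring
  rw [e, h1, hp, hq] at h2
  rcases mul_pos_iff.1 h with ⟨hr, hs⟩ | ⟨hr, hs⟩
  · rcases ha'.eq_or_lt with h0 | h0
    · have : b' = 1 := by linarith
      nlinarith
    · nlinarith [mul_pos h0 hr, mul_nonneg hb' hs.le]
  · rcases ha'.eq_or_lt with h0 | h0
    · have : b' = 1 := by linarith
      nlinarith
    · nlinarith [mul_pos h0 (neg_pos.2 hr), mul_nonneg hb' (neg_pos.2 hs).le]

theorem continuous_orient {X : Type*} [TopologicalSpace X] {f g h : X → ℝ × ℝ}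
    (hf : Continuous f) (hg : Continuous g) (hh : Continuous h) :
    Continuous fun x => orient (f x) (g x) (h x) := by
  unfold orient
  fun_prop

theorem eventually_pos_of_continuous {f : ℝ → ℝ} (hf : Continuous f) (h : 0 < f 0) :
    ∀ᶠ t in 𝓝[>] (0 : ℝ), 0 < f t :=
  ((hf.tendsto 0).eventually (lt_mem_nhds h)).filter_mono nhdsWithin_le_nhds

theorem eventually_neg_of_continuous {f : ℝ → ℝ} (hf : Continuous f) (h : f 0 < 0) :
    ∀ᶠ t in 𝓝[>] (0 : ℝ), f t < 0 :=
  ((hf.tendsto 0).eventually (gt_mem_nhds h)).filter_mono nhdsWithin_le_nhds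

theorem eventually_crosses {f g : ℝ → ℝ × ℝ} {r s p q : ℝ × ℝ} (hf : Continuous f)
    (hg : Continuous g) (h : Crosses p q r s) (hp : f 0 = p) (hq : g 0 = q) :
    ∀ᶠ t in 𝓝[>] (0 : ℝ), Crosses (f t) (g t) r s := by
  subst hp hq
  exact (eventually_neg_of_continuous ((continuous_orient hf hg continuous_const).mul
    (continuous_orient hf hg continuous_const)) h.1).and
    (eventually_neg_of_continuous ((continuous_orient continuous_const continuous_const hf).mul
    (continuous_orient continuous_const continuous_const hg)) h.2)

/-! ### Segments close to a given segment -/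

/-- The point with first coordinate `x` on the line with slope `k` through `(c, 0)`. -/
def linePoint (k c x : ℝ) : ℝ × ℝ := (x, k * (x - c))

theorem orient_linePoint (k c x y : ℝ) (z : ℝ × ℝ) :
    orient (linePoint k c x) (linePoint k c y) z = (y - x) * (z.2 - k * (z.1 - c)) := by
  simp only [orient, linePoint]
  ring

theorem crosses_linePoint {τ k c x y k' c' x' y' : ℝ} (hτ : τ ≠ 0) (hxy : x ≠ y)
    (hxy' : x' ≠ y')
    (h : (k' * (x' - c') - k * (x' - c)) * (k' * (y' - c') - k * (y' - c)) < 0)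
    (h' : (k' * (x - c') - k * (x - c)) * (k' * (y - c') - k * (y - c)) < 0) :
    Crosses (linePoint (τ * k) c x) (linePoint (τ * k) c y)
      (linePoint (τ * k') c' x') (linePoint (τ * k') c' y') := by
  have h2 : 0 < τ ^ 2 * (y - x) ^ 2 := by have := sub_ne_zero.2 hxy.symm; positivity
  have h3 : 0 < τ ^ 2 * (y' - x') ^ 2 := by have := sub_ne_zero.2 hxy'.symm; positivity
  constructor
  · rw [orient_linePoint, orient_linePoint]
    simp only [linePoint]
    refine lt_of_eq_of_lt ?_ (mul_neg_of_pos_of_neg h2 h)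
    ring
  · rw [orient_linePoint, orient_linePoint]
    simp only [linePoint]
    refine lt_of_eq_of_lt ?_ (mul_neg_of_pos_of_neg h3 h')
    ring

theorem crosses_of_orient {A B p q : ℝ × ℝ} {k c x y : ℝ} (hA : A = linePoint k c x)
    (hB : B = linePoint k c y) (hxy : x ≠ y)
    (h : (p.2 - k * (p.1 - c)) * (q.2 - k * (q.1 - c)) < 0)
    (h' : orient p q A * orient p q B < 0) : Crosses A B p q := by
  refine ⟨?_, h'⟩
  subst hA hB
  rw [orient_linePoint, orient_linePoint]
  have h2 : 0 < (y - x) ^ 2 := by have := sub_ne_zero.2 hxy.symm; positivity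
  refine lt_of_eq_of_lt ?_ (mul_neg_of_pos_of_neg h2 h)
  ring

/-- The construction of `exists_split` for given parameters. All new segments lie on lines of slope
`O(ε)`: `CD` on the line through `(1 - δ, 0)`, `A'B'` on the line through `(m, 0)`, and `A''B''` on
the line through the tip `(p, 0)` of `w`. -/
theorem exists_split_of_parameters {ι : Type*} [Finite ι] (P Q : ι → ℝ × ℝ)
    {α β p w σ m ρ δ N : ℝ} {ca cw : Prop} (hαβ : α * β < 0)
    (hm0 : 0 < m) (hσ : σ ≠ 0)
    (hmσ : 0 < σ * (m - p)) (hσw : cw ∧ 0 < σ ∨ ¬ cw ∧ σ < 0)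
    (hρ : ρ = 1 ∨ ρ = -1) (hρa : ca ∧ ρ = -1 ∨ ¬ ca ∧ ρ = 1)
    (hc1 : ∀ i, Crosses (1, 0) (ρ * δ, 0) (P i) (Q i))
    (hc2 : ∀ i, Crosses (0, 0) (1 + δ, 0) (P i) (Q i))
    (hc3 : ∀ i, Crosses (1 - δ / 2, 0) (-δ, 0) (P i) (Q i))
    (hδ0 : 0 < δ) (hδ2 : 0 < 1 - m - δ) (hδ3 : 0 < (1 - p) - 2 * δ)
    (hδ4 : 0 < p - δ) (hN : N = 1 - δ / 2 - p)
    (hd1 : 0 < m * (2 * N) - p * (1 - m))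
    (hd2 : 0 < (δ + m) * (2 * N) - (p + δ) * (1 - m))
    (hd3 : 0 < (1 + δ - m) * (2 * N) - (1 + δ - p) * (1 - m)) :
    ∃ C D A' B' A'' B'' : ℝ × ℝ, C ≠ D ∧
      (Meets C D (0, α) (0, β) ↔ ca) ∧ (Meets C D (p, 0) (w, 1) ↔ cw) ∧
      (∀ i, Crosses C D (P i) (Q i)) ∧ (∀ i, Crosses A' B' (P i) (Q i)) ∧
      (∀ i, Crosses A'' B'' (P i) (Q i)) ∧
      Crosses (0, 0) (1, 0) C D ∧ Crosses (0, 0) (1, 0) A' B' ∧ Crosses (0, 0) (1, 0) A'' B'' ∧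
      Crosses A' B' A'' B'' ∧
      StartsOn A' B' (0, α) (0, β) ∧ PassesTip A' B' C D ∧ Crosses A' B' (p, 0) (w, 1) ∧
      StartsOn A'' B'' C D ∧ PassesTip A'' B'' (p, 0) (w, 1) ∧
      Crosses A'' B'' (0, α) (0, β) := by
  have hαβ' : 0 < (α - β) ^ 2 := by nlinarith [sq_nonneg (α + β)]
  have hv : ∀ z z' : ℝ × ℝ, orient (0, α) (0, β) z * orient (0, α) (0, β) z' =
      (α - β) ^ 2 * (z.1 * z'.1) := fun z z' => by simp only [orient]; ring
  have hm1' : 0 < 1 - m := by linarith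
  have hp1' : 0 < 1 - p := by linarith
  have hN0 : 0 < N := by linarith
  obtain ⟨kf, hkf⟩ : ∃ k, k = -1 / δ := ⟨_, rfl⟩
  obtain ⟨kg, hkg⟩ : ∃ k, k = -1 / (2 * N) := ⟨_, rfl⟩
  obtain ⟨ke, hke⟩ : ∃ k, k = -1 / (1 - m) := ⟨_, rfl⟩
  have hkf' : kf * δ = -1 := by rw [hkf]; field_simp
  have hkg' : kg * N = -1 / 2 := by rw [hkg]; field_simp
  have hke' : ke * (1 - m) = -1 := by rw [hke]; field_simp
  have hkf0 : kf < 0 := by rw [hkf]; exact div_neg_of_neg_of_pos (by norm_num) hδ0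
  have hkg0 : kg < 0 := by rw [hkg]; exact div_neg_of_neg_of_pos (by norm_num) (by positivity)
  have hke0 : ke < 0 := by rw [hke]; exact div_neg_of_neg_of_pos (by norm_num) hm1'
  have hkfe : kf < ke := by
    rw [hkf, hke, div_lt_div_iff₀ hδ0 hm1']; linarith
  have hkfg : kf < kg := by
    rw [hkf, hkg, div_lt_div_iff₀ hδ0 (by positivity)]; linarith
  clear hkf hkg hke
  obtain ⟨hρ1, hρp⟩ : ρ * δ < 1 - δ ∧ ρ * δ < p := by
    rcases hρ with rfl | rfl <;> refine ⟨?_, ?_⟩ <;> linarith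
  have hlp : ∀ k c x : ℝ, Continuous fun ε => linePoint (σ * ε * k) c x := by
    intro k c x
    unfold linePoint
    fun_prop
  have hlp0 : ∀ k c x : ℝ, linePoint (σ * 0 * k) c x = (x, 0) := by
    intro k c x
    simp [linePoint]
  have hev : ∀ k c x y : ℝ, (∀ i, Crosses (x, 0) (y, 0) (P i) (Q i)) → ∀ᶠ ε in 𝓝[>] (0 : ℝ),
      ∀ i, Crosses (linePoint (σ * ε * k) c x) (linePoint (σ * ε * k) c y) (P i) (Q i) :=
    fun k c x y h => eventually_all.2 fun i => eventually_crosses (hlp k c x) (hlp k c y) (h i)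
      (hlp0 k c x) (hlp0 k c y)
  have heva : ∀ k c : ℝ, ∀ᶠ ε in 𝓝[>] (0 : ℝ),
      (α - σ * ε * k * (0 - c)) * (β - σ * ε * k * (0 - c)) < 0 :=
    fun k c => eventually_neg_of_continuous (by fun_prop) (by simpa using hαβ)
  have hevw : ∀ k c : ℝ, ∀ᶠ ε in 𝓝[>] (0 : ℝ), 0 < 1 - σ * ε * k * (w - c) :=
    fun k c => eventually_pos_of_continuous (by fun_prop) (by simp)
  have hevo : ∀ k c x y : ℝ, (x - p) * (y - p) < 0 → ∀ᶠ ε in 𝓝[>] (0 : ℝ),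
      orient (p, 0) (w, 1) (linePoint (σ * ε * k) c x) *
      orient (p, 0) (w, 1) (linePoint (σ * ε * k) c y) < 0 := by
    intro k c x y h
    refine eventually_neg_of_continuous
      ((continuous_orient continuous_const continuous_const (hlp k c x)).mul
      (continuous_orient continuous_const continuous_const (hlp k c y))) ?_
    rw [hlp0, hlp0]
    simp only [orient]
    linarith
  -- the vertical scale `ε`
  have ev1 := (hev kf (1 - δ) 1 (ρ * δ) hc1).and
    ((hev ke m 0 (1 + δ) hc2).and (hev kg p (1 - δ / 2) (-δ) hc3))
  have ev2 := (heva kf (1 - δ)).and ((heva ke m).and (heva kg p))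
  have ev3 := (hevw kf (1 - δ)).and ((hevw ke m).and (hevw kg p))
  have ev4 := (hevo kf (1 - δ) 1 (ρ * δ) (mul_neg_of_pos_of_neg hp1' (by linarith))).and
    ((hevo ke m 0 (1 + δ) (mul_neg_of_neg_of_pos (by linarith) (by linarith))).and
    (hevo kg p (1 - δ / 2) (-δ) (mul_neg_of_pos_of_neg (by linarith) (by linarith))))
  have ev5 : ∀ᶠ ε in 𝓝[>] (0 : ℝ), 0 < ε := self_mem_nhdsWithin
  obtain ⟨ε, ⟨h1, h2, h3⟩, ⟨h4, h5, h6⟩, ⟨h7, h8, h9⟩, ⟨h10, h11, h12⟩, hε⟩ :=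
    (ev1.and (ev2.and (ev3.and (ev4.and ev5)))).exists
  clear ev1 ev2 ev3 ev4 ev5 hev heva hevw hevo hlp hlp0 hc1 hc2 hc3
  have hτ : σ * ε ≠ 0 := mul_ne_zero hσ hε.ne'
  -- signs of the four linear functions and of their differences, up to the factor `σ * ε`
  have f0 : 0 < kf * (0 - (1 - δ)) := mul_pos_of_neg_of_neg hkf0 (by linarith)
  have f1 : kf * (1 - (1 - δ)) < 0 := mul_neg_of_neg_of_pos hkf0 (by linarith)
  have fp : 0 < kf * (p - (1 - δ)) := mul_pos_of_neg_of_neg hkf0 (by linarith)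
  have fx : 0 < kf * (ρ * δ - (1 - δ)) := mul_pos_of_neg_of_neg hkf0 (by linarith)
  have e0 : 0 < ke * (0 - m) := mul_pos_of_neg_of_neg hke0 (by linarith)
  have e1 : ke * (1 - m) < 0 := mul_neg_of_neg_of_pos hke0 (by linarith)
  have e2 : ke * (1 + δ - m) < 0 := mul_neg_of_neg_of_pos hke0 (by linarith)
  have g0 : 0 < kg * (0 - p) := mul_pos_of_neg_of_neg hkg0 (by linarith)
  have g1 : kg * (1 - p) < 0 := mul_neg_of_neg_of_pos hkg0 (by linarith)
  have g2 : kg * (1 - δ / 2 - p) < 0 := mul_neg_of_neg_of_pos hkg0 (by linarith)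
  have gd : 0 < kg * (-δ - p) := mul_pos_of_neg_of_neg hkg0 (by linarith)
  have ge : ∀ x, kg * (x - p) - ke * (x - m) =
      kg * ke * ((x - m) * (2 * N) - (x - p) * (1 - m)) := fun x => by
    linear_combination -2 * (x - m) * ke * hkg' + kg * (x - p) * hke'
  have hgke : 0 < kg * ke := mul_pos_of_neg_of_neg hkg0 hke0
  have ge0 : kg * (0 - p) - ke * (0 - m) < 0 := by
    rw [ge]; exact mul_neg_of_pos_of_neg hgke (by linarith)
  have ged : kg * (-δ - p) - ke * (-δ - m) < 0 := by
    rw [ge]; exact mul_neg_of_pos_of_neg hgke (by linarith)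
  have ge2 : 0 < kg * (1 + δ - p) - ke * (1 + δ - m) := by
    rw [ge]; exact mul_pos hgke (by linarith)
  have ge1 : 0 < kg * (1 - δ / 2 - p) - ke * (1 - δ / 2 - m) := by
    rw [← hN]
    have := mul_pos_of_neg_of_neg hke0 (show m + δ / 2 - 1 + (1 - m) / 2 < 0 by linarith)
    linarith
  have hfe : ∀ x, kf * (x - (1 - δ)) - ke * (x - m) = (kf - ke) * (x - 1) := fun x => by
    linear_combination hkf' - hke'
  have hfg : ∀ x, kf * (x - (1 - δ)) - kg * (x - p) = (kf - kg) * (x - (1 - δ / 2)) := fun x => by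
    linear_combination hkf' / 2 - hkg' + kg * hN
  have hz : ∀ x : ℝ, (x, (0 : ℝ)) = linePoint (σ * ε * 0) 0 x := fun x => by simp [linePoint]
  refine ⟨linePoint (σ * ε * kf) (1 - δ) 1, linePoint (σ * ε * kf) (1 - δ) (ρ * δ),
    linePoint (σ * ε * ke) m 0, linePoint (σ * ε * ke) m (1 + δ),
    linePoint (σ * ε * kg) p (1 - δ / 2), linePoint (σ * ε * kg) p (-δ), ?_, ?_, ?_, h1, h2, h3,
    ?_, ?_, ?_, ?_, ?_, ?_, ?_, ?_, ?_, ?_⟩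
  · intro h
    have := congrArg Prod.fst h
    simp only [linePoint] at this
    linarith
  · rcases hρa with ⟨hca, rfl⟩ | ⟨hca, rfl⟩
    · refine iff_of_true (crosses_of_orient rfl rfl (by linarith) h4 ?_).meets hca
      rw [hv]
      exact mul_neg_of_pos_of_neg hαβ' (show 1 * (-1 * δ) < 0 by linarith)
    · refine iff_of_false (fun h => not_meets_of_orient_mul_pos ?_ h.symm) hca
      rw [hv]
      exact mul_pos hαβ' (show 0 < 1 * (1 * δ) by linarith)
  · rcases hσw with ⟨hcw, hσ'⟩ | ⟨hcw, hσ'⟩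
    · refine iff_of_true (crosses_of_orient rfl rfl (by linarith) ?_ h10).meets hcw
      refine mul_neg_of_neg_of_pos ?_ h7
      have := mul_pos (mul_pos hσ' hε) fp
      linarith
    · refine iff_of_false (not_meets_of_orient_mul_pos ?_) hcw
      rw [orient_linePoint, orient_linePoint]
      have h13 : 0 < 0 - σ * ε * kf * (p - (1 - δ)) := by
        have := mul_neg_of_neg_of_pos (mul_neg_of_neg_of_pos hσ' hε) fp
        linarith
      have h14 : 0 < (ρ * δ - 1) ^ 2 := sq_pos_of_neg (by linarith)
      refine lt_of_lt_of_eq (mul_pos h14 (mul_pos h13 h7)) ?_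
      ring
  · rw [hz, hz]
    refine crosses_linePoint hτ (by norm_num) (by linarith) ?_ ?_
    · rw [zero_mul, zero_mul, sub_zero, sub_zero]
      exact mul_neg_of_neg_of_pos f1 fx
    · rw [zero_mul, zero_mul, sub_zero, sub_zero]
      exact mul_neg_of_pos_of_neg f0 f1
  · rw [hz, hz]
    refine crosses_linePoint hτ (by norm_num) (by linarith) ?_ ?_
    · rw [zero_mul, zero_mul, sub_zero, sub_zero]
      exact mul_neg_of_pos_of_neg e0 e2
    · rw [zero_mul, zero_mul, sub_zero, sub_zero]
      exact mul_neg_of_pos_of_neg e0 e1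
  · rw [hz, hz]
    refine crosses_linePoint hτ (by norm_num) (by linarith) ?_ ?_
    · rw [zero_mul, zero_mul, sub_zero, sub_zero]
      exact mul_neg_of_neg_of_pos g2 gd
    · rw [zero_mul, zero_mul, sub_zero, sub_zero]
      exact mul_neg_of_pos_of_neg g0 g1
  · refine crosses_linePoint hτ (by linarith) (by linarith) ?_ ?_
    · exact mul_neg_of_pos_of_neg ge1 ged
    · exact mul_neg_of_neg_of_pos ge0 ge2
  · refine ⟨by simp [orient, linePoint], ?_⟩
    rw [orient_linePoint, orient_linePoint]
    have h14 : 0 < (1 + δ - 0) ^ 2 := sq_pos_of_pos (by linarith)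
    refine lt_of_eq_of_lt ?_ (mul_neg_of_pos_of_neg h14 h5)
    ring
  · refine ⟨?_, ?_, ?_⟩
    · rw [orient_linePoint]
      simp only [linePoint]
      linear_combination (1 + δ - 0) * (σ * ε) * hfe 1
    · rw [orient_linePoint]
      simp only [linePoint]
      have : σ * ε * kf * (ρ * δ - (1 - δ)) - σ * ε * ke * (ρ * δ - m) =
        σ * ε * ((kf - ke) * (ρ * δ - 1)) := by rw [← hfe]; ring
      rw [this]
      exact mul_ne_zero (by linarith) (mul_ne_zero hτ (mul_ne_zero (by linarith) (by linarith)))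
    · rw [orient_linePoint, orient_linePoint]
      simp only [linePoint]
      have e : ∀ x, σ * ε * ke * (x - m) - σ * ε * kf * (x - (1 - δ)) =
        -(σ * ε * ((kf - ke) * (x - 1))) := fun x => by rw [← hfe]; ring
      rw [e, e]
      have h14 : 0 < (σ * ε) ^ 2 * (kf - ke) ^ 2 * (ρ * δ - 1) ^ 2 * δ := by
        have h15 : kf - ke ≠ 0 := by linarith
        have h16 : ρ * δ - 1 ≠ 0 := by linarith
        positivity
      linarith
  · refine crosses_of_orient rfl rfl (by linarith) ?_ h11
    refine mul_neg_of_neg_of_pos ?_ h8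
    have := mul_pos (mul_pos hmσ hε) (neg_pos.2 hke0)
    linarith
  · refine ⟨?_, ?_⟩
    · rw [orient_linePoint]
      simp only [linePoint]
      linear_combination -(ρ * δ - 1) * (σ * ε) * hfg (1 - δ / 2)
    · rw [orient_linePoint, orient_linePoint]
      simp only [linePoint]
      have e : ∀ x, σ * ε * kf * (x - (1 - δ)) - σ * ε * kg * (x - p) =
        σ * ε * ((kf - kg) * (x - (1 - δ / 2))) := fun x => by rw [← hfg]; ring
      rw [e, e]
      have h14 : 0 < (σ * ε) ^ 2 * (kf - kg) ^ 2 * (-δ - (1 - δ / 2)) ^ 2 * (δ / 2) *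
          (1 - δ / 2 - ρ * δ) := by
        have h15 : kf - kg ≠ 0 := by linarith
        have h16 : -δ - (1 - δ / 2) ≠ 0 := by linarith
        have h17 : 0 < 1 - δ / 2 - ρ * δ := by linarith
        positivity
      linarith
  · refine ⟨by rw [orient_linePoint]; simp, ?_, h12⟩
    rw [orient_linePoint]
    exact mul_ne_zero (by linarith) h9.ne'
  · refine crosses_of_orient rfl rfl (by linarith) h6 ?_
    rw [hv]
    exact mul_neg_of_pos_of_neg hαβ' (mul_neg_of_pos_of_neg (show 0 < 1 - δ / 2 by linarith)
      (neg_neg_of_pos hδ0))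

/-- Let the segment from `(0, 0)` to `(1, 0)` start in an interior point of the vertical segment
`a`, pass the lower end of `w`, and cross finitely many other segments. Close to it there are a
segment `CD` that meets the others and, as prescribed, meets or avoids `a` and `w`, a segment
`A'B'` in the same position with respect to `a` and `CD`, and a segment `A''B''` in the same
position with respect to `CD` and `w`; all other pairs cross. -/
theorem exists_split {ι : Type*} [Finite ι] (P Q : ι → ℝ × ℝ)
    (hPQ : ∀ i, Crosses (0, 0) (1, 0) (P i) (Q i)) {α β p w : ℝ} (hαβ : α * β < 0)
    (hp0 : 0 < p) (hp1 : p < 1) (ca cw : Prop) :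
    ∃ C D A' B' A'' B'' : ℝ × ℝ, C ≠ D ∧
      (Meets C D (0, α) (0, β) ↔ ca) ∧ (Meets C D (p, 0) (w, 1) ↔ cw) ∧
      (∀ i, Crosses C D (P i) (Q i)) ∧ (∀ i, Crosses A' B' (P i) (Q i)) ∧
      (∀ i, Crosses A'' B'' (P i) (Q i)) ∧
      Crosses (0, 0) (1, 0) C D ∧ Crosses (0, 0) (1, 0) A' B' ∧ Crosses (0, 0) (1, 0) A'' B'' ∧
      Crosses A' B' A'' B'' ∧
      StartsOn A' B' (0, α) (0, β) ∧ PassesTip A' B' C D ∧ Crosses A' B' (p, 0) (w, 1) ∧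
      StartsOn A'' B'' C D ∧ PassesTip A'' B'' (p, 0) (w, 1) ∧
      Crosses A'' B'' (0, α) (0, β) := by
  -- `CD` and `A'B'` are tilted upwards or downwards with the sign of `σ`: at the tip `(p, 0)` the
  -- first is above the axis if and only if `0 < σ`, while the second must always be above it, which
  -- decides on which side of `p` its zero `m` lies. If `m < p`, then `m` must still be so close to
  -- `p` that `A'B'` and `A''B''` cross.
  obtain ⟨σ, m, hm0, hm1, hσ, hmp, hmσ, hσw⟩ : ∃ σ m : ℝ, 0 < m ∧ m < 1 ∧ σ ≠ 0 ∧
      p * (1 - m) < 2 * m * (1 - p) ∧ 0 < σ * (m - p) ∧ (cw ∧ 0 < σ ∨ ¬ cw ∧ σ < 0) := by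
    by_cases h : cw
    · exact ⟨1, (1 + p) / 2, by linarith, by linarith, by norm_num, by nlinarith, by linarith,
        .inl ⟨h, one_pos⟩⟩
    · exact ⟨-1, p * (1 + p) / 2, by positivity, by nlinarith, by norm_num,
        by nlinarith [mul_pos hp0 (sub_pos.2 hp1)], by nlinarith [mul_pos hp0 (sub_pos.2 hp1)],
        .inr ⟨h, by norm_num⟩⟩
  -- `CD` begins at abscissa `ρ * δ`, to the left of `a` or to the right of it
  obtain ⟨ρ, hρ, hρa⟩ : ∃ ρ : ℝ, (ρ = 1 ∨ ρ = -1) ∧ (ca ∧ ρ = -1 ∨ ¬ ca ∧ ρ = 1) := by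
    by_cases h : ca
    · exact ⟨-1, .inr rfl, .inl ⟨h, rfl⟩⟩
    · exact ⟨1, .inl rfl, .inr ⟨h, rfl⟩⟩
  have hm1' : 0 < 1 - m := by linarith
  have hp1' : 0 < 1 - p := by linarith
  have hswap : ∀ i, Crosses (1, 0) (0, 0) (P i) (Q i) := fun i =>
    ⟨by have := (hPQ i).1; simp only [orient] at this ⊢; linarith,
      by rw [mul_comm]; exact (hPQ i).2⟩
  -- the horizontal overlap `δ`
  have ev1 := eventually_all.2 fun i => eventually_crosses (f := fun δ => (1, 0))
    (g := fun δ => (ρ * δ, 0)) (by fun_prop) (by fun_prop) (hswap i) rfl (by simp)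
  have ev2 := eventually_all.2 fun i => eventually_crosses (f := fun δ => (0, 0))
    (g := fun δ => (1 + δ, 0)) (by fun_prop) (by fun_prop) (hPQ i) rfl (by simp)
  have ev3 := eventually_all.2 fun i => eventually_crosses (f := fun δ => (1 - δ / 2, 0))
    (g := fun δ => (-δ, 0)) (by fun_prop) (by fun_prop) (hswap i) (by simp) (by simp)
  have ev4 := eventually_pos_of_continuous (f := fun δ => 1 - m - δ) (by fun_prop)
    (by simpa using hm1)
  have ev5 := eventually_pos_of_continuous (f := fun δ => (1 - p) - 2 * δ) (by fun_prop)
    (by simpa using hp1)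
  have ev6 := eventually_pos_of_continuous (f := fun δ => p - δ) (by fun_prop) (by simpa using hp0)
  have ev7 := eventually_pos_of_continuous
    (f := fun δ => m * (2 * (1 - δ / 2 - p)) - p * (1 - m)) (by fun_prop) (by linarith)
  have ev8 := eventually_pos_of_continuous
    (f := fun δ => (δ + m) * (2 * (1 - δ / 2 - p)) - (p + δ) * (1 - m)) (by fun_prop)
    (by linarith)
  have ev9 := eventually_pos_of_continuous
    (f := fun δ => (1 + δ - m) * (2 * (1 - δ / 2 - p)) - (1 + δ - p) * (1 - m)) (by fun_prop)
    (by nlinarith [mul_pos hm1' hp1'])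
  have ev0 : ∀ᶠ δ in 𝓝[>] (0 : ℝ), 0 < δ := self_mem_nhdsWithin
  obtain ⟨δ, ⟨hc1, hc2, hc3⟩, ⟨hδ1, hδ2, hδ3⟩, ⟨hd1, hd2, hd3⟩, hδ0⟩ :=
    ((ev1.and (ev2.and ev3)).and ((ev4.and (ev5.and ev6)).and
      ((ev7.and (ev8.and ev9)).and ev0))).exists
  exact exists_split_of_parameters P Q hαβ hm0 hσ hmσ hσw hρ hρa hc1 hc2 hc3 hδ0 hδ1 hδ2 hδ3 rfl
    hd1 hd2 hd3

/-! ### Affine changes of coordinates -/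

/-- The affine map `T` of the plane multiplies signed areas by the non-zero factor `D`. -/
def ScalesOrient (T : ℝ × ℝ →ᵃ[ℝ] ℝ × ℝ) (D : ℝ) : Prop :=
  D ≠ 0 ∧ ∀ p q r, orient (T p) (T q) (T r) = D * orient p q r

theorem ScalesOrient.injective {T : ℝ × ℝ →ᵃ[ℝ] ℝ × ℝ} {D : ℝ} (hT : ScalesOrient T D) :
    Function.Injective T := by
  intro p q h
  have h1 := hT.2 p q (p.1 + 1, p.2)
  have h2 := hT.2 p q (p.1, p.2 + 1)
  rw [h, show ∀ x y, orient x x y = 0 by intro x y; simp [orient], eq_comm, mul_eq_zero,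
    or_iff_right hT.1] at h1 h2
  simp only [orient] at h1 h2
  exact Prod.ext (by linarith) (by linarith)

theorem ScalesOrient.mul_neg {T : ℝ × ℝ →ᵃ[ℝ] ℝ × ℝ} {D : ℝ} (hT : ScalesOrient T D)
    {p q r p' q' r' : ℝ × ℝ} (h : orient p q r * orient p' q' r' < 0) :
    orient (T p) (T q) (T r) * orient (T p') (T q') (T r') < 0 := by
  rw [hT.2, hT.2]
  have : 0 < D ^ 2 := by have := hT.1; positivity
  nlinarith

theorem ScalesOrient.crosses {T : ℝ × ℝ →ᵃ[ℝ] ℝ × ℝ} {D : ℝ} (hT : ScalesOrient T D)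
    {p q r s : ℝ × ℝ} (h : Crosses p q r s) : Crosses (T p) (T q) (T r) (T s) :=
  ⟨hT.mul_neg h.1, hT.mul_neg h.2⟩

theorem ScalesOrient.startsOn {T : ℝ × ℝ →ᵃ[ℝ] ℝ × ℝ} {D : ℝ} (hT : ScalesOrient T D)
    {p q r s : ℝ × ℝ} (h : StartsOn p q r s) : StartsOn (T p) (T q) (T r) (T s) :=
  ⟨by rw [hT.2, h.1, mul_zero], hT.mul_neg h.2⟩

theorem ScalesOrient.passesTip {T : ℝ × ℝ →ᵃ[ℝ] ℝ × ℝ} {D : ℝ} (hT : ScalesOrient T D)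
    {p q r s : ℝ × ℝ} (h : PassesTip p q r s) : PassesTip (T p) (T q) (T r) (T s) :=
  ⟨by rw [hT.2, h.1, mul_zero], by rw [hT.2]; exact mul_ne_zero hT.1 h.2.1, hT.mul_neg h.2.2⟩

theorem ScalesOrient.meets_iff {T : ℝ × ℝ →ᵃ[ℝ] ℝ × ℝ} {D : ℝ} (hT : ScalesOrient T D)
    {p q r s : ℝ × ℝ} : Meets (T p) (T q) (T r) (T s) ↔ Meets p q r s := by
  rw [Meets, Meets, ← image_segment, ← image_segment, ← Set.image_inter hT.injective,
    Set.image_nonempty]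

theorem exists_affineMap (a b c a' b' c' : ℝ) :
    ∃ T : ℝ × ℝ →ᵃ[ℝ] ℝ × ℝ, ∀ z, T z = (a * z.1 + b * z.2 + c, a' * z.1 + b' * z.2 + c') := by
  refine ⟨((a • LinearMap.fst ℝ ℝ ℝ + b • LinearMap.snd ℝ ℝ ℝ).prod
    (a' • LinearMap.fst ℝ ℝ ℝ + b' • LinearMap.snd ℝ ℝ ℝ)).toAffineMap +
    AffineMap.const ℝ (ℝ × ℝ) (c, c'), fun z => ?_⟩
  simp

/-- Coordinates in which a segment `AB` that starts on `pq` and passes the tip of `rs` becomes the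
segment from `(0, 0)` to `(1, 0)`, while `pq` becomes vertical and the other end of `rs` gets
height one. -/
theorem exists_normalizing_map {A B p q r s : ℝ × ℝ} (h : StartsOn A B p q)
    (h' : PassesTip A B r s) :
    ∃ (T : ℝ × ℝ →ᵃ[ℝ] ℝ × ℝ) (D α β t w : ℝ), ScalesOrient T D ∧ T A = (0, 0) ∧ T B = (1, 0) ∧
      T p = (0, α) ∧ T q = (0, β) ∧ α * β < 0 ∧ T r = (t, 0) ∧ T s = (w, 1) ∧ 0 < t ∧ t < 1 := by
  obtain ⟨h1, h2⟩ := h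
  obtain ⟨h3, h4, h5⟩ := h'
  have hB : orient p q B = orient A B p - orient A B q := by
    have : orient p q B = orient p q A + (orient A B p - orient A B q) := by
      simp only [orient]; ring
    rw [this, h1, zero_add]
  have hne : orient A B p - orient A B q ≠ 0 := fun h => by
    rw [sub_eq_zero] at h
    rw [h] at h2
    nlinarith [mul_self_nonneg (orient A B p)]
  rw [← hB] at hne
  set d := orient p q B with hd
  set e := orient A B s with he
  obtain ⟨T, hT⟩ := exists_affineMap (-(q.2 - p.2) / d) ((q.1 - p.1) / d)
    (((q.2 - p.2) * p.1 - (q.1 - p.1) * p.2) / d) (-(B.2 - A.2) / e) ((B.1 - A.1) / e)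
    (((B.2 - A.2) * A.1 - (B.1 - A.1) * A.2) / e)
  have hT' : ∀ z, T z = (orient p q z / d, orient A B z / e) := fun z => by
    rw [hT]
    refine Prod.ext ?_ ?_ <;> simp only [orient] <;> ring
  have hS : ScalesOrient T (1 / e) := by
    refine ⟨one_div_ne_zero h4, fun x y z => ?_⟩
    have key : orient (T x) (T y) (T z) = (orient A B p - orient A B q) / (d * e) * orient x y z := by
      simp only [hT, orient]
      field_simp
      ring
    rw [key, ← hB]
    field_simp
  have self1 : ∀ x y, orient x y x = 0 := fun x y => by simp [orient]
  have self2 : ∀ x y, orient x y y = 0 := fun x y => by simp only [orient]; ring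
  have hTA : T A = (0, 0) := by rw [hT', h1, self1]; simp
  have hTB : T B = (1, 0) := by rw [hT', self2, div_self hne]; simp
  have hTr : T r = (orient p q r / d, 0) := by rw [hT', h3]; simp
  have hTs : T s = (orient p q s / d, 1) := by rw [hT', div_self h4]
  have h6 := hS.mul_neg h5
  rw [hTA, hTB, hTr, hTs] at h6
  simp only [orient] at h6
  refine ⟨T, 1 / e, orient A B p / e, orient A B q / e, orient p q r / d, orient p q s / d, hS,
    hTA, hTB, by rw [hT', self1]; simp, by rw [hT', self2]; simp, ?_, hTr, hTs, ?_, ?_⟩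
  · rw [div_mul_div_comm]
    exact div_neg_of_neg_of_pos h2 (mul_self_pos.2 h4)
  all_goals
    simp only [orient]
    nlinarith

/-! ### Segment representations of complements of two-trees -/

open SimpleGraph

/-- A segment representation of the complement of a subgraph `G` of the 2-tree `(S, E)`: the vertex
`v` is represented by the segment from `P v` to `Q v`. In addition, every edge of the 2-tree has a
placeholder for a vertex that is joined to both ends of this edge, indexed by a finite type `L`:
the segment from `A l` to `B l` starts on the segment of the end `a l`, passes the tip of the end
`w l`, and properly crosses all other segments and placeholders. The tip of `v` is always `P v`. -/
structure IsArrangement {V L : Type*} (G : SimpleGraph V) (S : Set V) (E : Set (Sym2 V))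
    (P Q : V → ℝ × ℝ) (A B : L → ℝ × ℝ) (a w : L → V) : Prop where
  ne : ∀ v ∈ S, P v ≠ Q v
  adj_iff : ∀ u ∈ S, ∀ v ∈ S, u ≠ v → (G.Adj u v ↔ ¬ Meets (P u) (Q u) (P v) (Q v))
  mem_left : ∀ l, a l ∈ S
  mem_right : ∀ l, w l ∈ S
  ends_ne : ∀ l, a l ≠ w l
  startsOn : ∀ l, StartsOn (A l) (B l) (P (a l)) (Q (a l))
  passesTip : ∀ l, PassesTip (A l) (B l) (P (w l)) (Q (w l))
  crosses : ∀ l, ∀ v ∈ S, v ≠ a l → v ≠ w l → Crosses (A l) (B l) (P v) (Q v)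
  crosses_placeholder : ∀ l l', l ≠ l' → Crosses (A l) (B l) (A l') (B l')
  cover : ∀ e ∈ E, ∃ l, e = s(a l, w l)

theorem IsArrangement.map {V L : Type*} {G : SimpleGraph V} {S : Set V} {E : Set (Sym2 V)}
    {P Q : V → ℝ × ℝ} {A B : L → ℝ × ℝ} {a w : L → V} (h : IsArrangement G S E P Q A B a w)
    {T : ℝ × ℝ →ᵃ[ℝ] ℝ × ℝ} {D : ℝ} (hT : ScalesOrient T D) :
    IsArrangement G S E (T ∘ P) (T ∘ Q) (T ∘ A) (T ∘ B) a w where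
  ne v hv e := h.ne v hv (hT.injective e)
  adj_iff u hu v hv huv := (h.adj_iff u hu v hv huv).trans (not_congr hT.meets_iff.symm)
  mem_left := h.mem_left
  mem_right := h.mem_right
  ends_ne := h.ends_ne
  startsOn l := hT.startsOn (h.startsOn l)
  passesTip l := hT.passesTip (h.passesTip l)
  crosses l v hv h1 h2 := hT.crosses (h.crosses l v hv h1 h2)
  crosses_placeholder l l' hl := hT.crosses (h.crosses_placeholder l l' hl)
  cover := h.cover

theorem exists_isArrangement_edge {V : Type*} (G : SimpleGraph V) {x y : V} (hxy : x ≠ y) :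
    ∃ (P Q : V → ℝ × ℝ) (A B : Unit → ℝ × ℝ) (a w : Unit → V),
      IsArrangement G {x, y} {s(x, y)} P Q A B a w := by
  classical
  obtain ⟨z, hz, hz'⟩ : ∃ z : ℝ × ℝ, z.2 = 1 ∧
      (G.Adj x y ↔ ¬ Meets (0, -1) (0, 1) (1, 0) z) := by
    by_cases h : G.Adj x y
    · exact ⟨(1, 1), rfl, iff_of_true h (not_meets_of_orient_mul_pos (by norm_num [orient]))⟩
    · refine ⟨(-1, 1), rfl, iff_of_false h (not_not_intro (Crosses.meets ⟨?_, ?_⟩))⟩ <;>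
        norm_num [orient]
  refine ⟨fun v => if v = x then (0, -1) else (1, 0), fun v => if v = x then (0, 1) else z,
    fun _ => (0, 0), fun _ => (2, 0), fun _ => x, fun _ => y, ?_, ?_, ?_, ?_, ?_, ?_, ?_, ?_, ?_, ?_⟩
  · rintro v (rfl | rfl)
    · norm_num
    · rw [if_neg hxy.symm, if_neg hxy.symm]
      rintro rfl
      norm_num at hz
  · rintro u (rfl | rfl) v (rfl | rfl) huv
    · exact absurd rfl huv
    · simpa only [if_true, if_neg hxy.symm] using hz'
    · rw [adj_comm, meets_comm]
      simpa only [if_true, if_neg hxy.symm] using hz'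
    · exact absurd rfl huv
  · simp
  · simp
  · exact fun _ => hxy
  · intro _
    norm_num [StartsOn, orient]
  · intro _
    norm_num [PassesTip, orient, hxy.symm, hz]
  · rintro _ v (rfl | rfl) h1 h2
    · exact absurd rfl h1
    · exact absurd rfl h2
  · exact fun _ _ h => absurd rfl h
  · rintro e rfl
    exact ⟨(), rfl⟩

/-- A new vertex `c` replaces the placeholder of the edge `xy`, and three new placeholders close to
it serve the edges `xy`, `xc` and `yc`. -/
theorem IsArrangement.exists_insert {V L : Type*} [Finite V] [Finite L] {G : SimpleGraph V}
    {S : Set V} {E : Set (Sym2 V)} {P Q : V → ℝ × ℝ} {A B : L → ℝ × ℝ} {a w : L → V}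
    (h : IsArrangement G S E P Q A B a w) {x y c : V} (hxy : s(x, y) ∈ E) (hc : c ∉ S)
    (hG : ∀ v ∈ S, G.Adj c v → v = x ∨ v = y) :
    ∃ (P' Q' : V → ℝ × ℝ) (A' B' : Option (Option L) → ℝ × ℝ) (a' w' : Option (Option L) → V),
      IsArrangement G (insert c S) (insert s(x, c) (insert s(y, c) E)) P' Q' A' B' a' w' := by
  classical
  obtain ⟨l, hl⟩ := h.cover _ hxy
  obtain ⟨T, D, α, β, t, x₁, hT, hA, hB, hPa, hQa, hαβ, hPw, hQw, ht0, ht1⟩ :=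
    exists_normalizing_map (h.startsOn l) (h.passesTip l)
  replace h := h.map hT
  set P₁ := T ∘ P
  set Q₁ := T ∘ Q
  set A₁ := T ∘ A
  set B₁ := T ∘ B
  change A₁ l = _ at hA
  change B₁ l = _ at hB
  change P₁ (a l) = _ at hPa
  change Q₁ (a l) = _ at hQa
  change P₁ (w l) = _ at hPw
  change Q₁ (w l) = _ at hQw
  clear_value P₁ Q₁ A₁ B₁
  let ι := {v // v ∈ S ∧ v ≠ a l ∧ v ≠ w l} ⊕ {k : L // k ≠ l}
  obtain ⟨C, D, A₂, B₂, A₃, B₃, hCD, hCa, hCw, hC, h2, h3, hlC, hl2, hl3, h23, h2a, h2C, h2w, h3C,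
      h3w, h3a⟩ := exists_split (ι := ι) (Sum.elim (fun v => P₁ v.1) fun k => A₁ k.1)
    (Sum.elim (fun v => Q₁ v.1) fun k => B₁ k.1) (by
      rintro (⟨v, hv, hva, hvw⟩ | ⟨k, hk⟩)
      · have := h.crosses l v hv hva hvw
        rwa [hA, hB] at this
      · have := h.crosses_placeholder l k hk.symm
        rwa [hA, hB] at this) hαβ ht0 ht1 (w := x₁) (¬ G.Adj c (a l)) (¬ G.Adj c (w l))
  rw [← hA, ← hB] at hlC hl2 hl3
  rw [← hPa, ← hQa] at hCa h2a h3a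
  rw [← hPw, ← hQw] at hCw h2w h3w
  have hCv : ∀ v ∈ S, v ≠ a l → v ≠ w l → Crosses C D (P₁ v) (Q₁ v) :=
    fun v hv h1 h2 => hC (.inl ⟨v, hv, h1, h2⟩)
  have hCk : ∀ k, Crosses C D (A₁ k) (B₁ k) := fun k => by
    by_cases hk : k = l
    · rw [hk]; exact hlC.symm
    · exact hC (.inr ⟨k, hk⟩)
  have h2v : ∀ v ∈ S, v ≠ a l → Crosses A₂ B₂ (P₁ v) (Q₁ v) := fun v hv h1 => by
    by_cases hvw : v = w l
    · rwa [hvw]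
    · exact h2 (.inl ⟨v, hv, h1, hvw⟩)
  have h2k : ∀ k, Crosses A₂ B₂ (A₁ k) (B₁ k) := fun k => by
    by_cases hk : k = l
    · rw [hk]; exact hl2.symm
    · exact h2 (.inr ⟨k, hk⟩)
  have h3v : ∀ v ∈ S, v ≠ w l → Crosses A₃ B₃ (P₁ v) (Q₁ v) := fun v hv h1 => by
    by_cases hva : v = a l
    · rwa [hva]
    · exact h3 (.inl ⟨v, hv, hva, h1⟩)
  have h3k : ∀ k, Crosses A₃ B₃ (A₁ k) (B₁ k) := fun k => by
    by_cases hk : k = l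
    · rw [hk]; exact hl3.symm
    · exact h3 (.inr ⟨k, hk⟩)
  have hmeets : ∀ v ∈ S, G.Adj c v ↔ ¬ Meets C D (P₁ v) (Q₁ v) := fun v hv => by
    by_cases hva : v = a l
    · rw [hva, hCa, not_not]
    by_cases hvw : v = w l
    · rw [hvw, hCw, not_not]
    refine iff_of_false (fun hcv => ?_) (not_not_intro (hCv v hv hva hvw).meets)
    have := hG v hv hcv
    rw [Sym2.eq_iff] at hl
    grind
  have hne : ∀ v ∈ S, v ≠ c := fun v hv hvc => hc (hvc ▸ hv)
  have hP : ∀ v ∈ S, Function.update P₁ c C v = P₁ v :=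
    fun v hv => Function.update_of_ne (hne v hv) _ _
  have hQ : ∀ v ∈ S, Function.update Q₁ c D v = Q₁ v :=
    fun v hv => Function.update_of_ne (hne v hv) _ _
  have hPc : Function.update P₁ c C c = C := Function.update_self _ _ _
  have hQc : Function.update Q₁ c D c = D := Function.update_self _ _ _
  have hal := h.mem_left l
  have hwl := h.mem_right l
  refine ⟨Function.update P₁ c C, Function.update Q₁ c D,
    fun o => o.elim A₂ fun o => o.elim A₃ A₁, fun o => o.elim B₂ fun o => o.elim B₃ B₁,
    fun o => o.elim (a l) fun o => o.elim c a, fun o => o.elim c fun o => o.elim (w l) w,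
    ?_, ?_, ?_, ?_, ?_, ?_, ?_, ?_, ?_, ?_⟩
  · rintro v (rfl | hv)
    · rwa [hPc, hQc]
    · rw [hP v hv, hQ v hv]
      exact h.ne v hv
  · rintro u (rfl | hu) v (rfl | hv) huv
    · exact absurd rfl huv
    · rw [hPc, hQc, hP v hv, hQ v hv]
      exact hmeets v hv
    · rw [hPc, hQc, hP u hu, hQ u hu, adj_comm, meets_comm]
      exact hmeets u hu
    · rw [hP u hu, hQ u hu, hP v hv, hQ v hv]
      exact h.adj_iff u hu v hv huv
  · rintro (_ | _ | k)
    · exact .inr hal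
    · exact .inl rfl
    · exact .inr (h.mem_left k)
  · rintro (_ | _ | k)
    · exact .inl rfl
    · exact .inr hwl
    · exact .inr (h.mem_right k)
  · rintro (_ | _ | k)
    · exact hne _ hal
    · exact (hne _ hwl).symm
    · exact h.ends_ne k
  · rintro (_ | _ | k)
    · simpa only [Option.elim, hP _ hal, hQ _ hal] using h2a
    · simpa only [Option.elim, hPc, hQc] using h3C
    · simpa only [Option.elim, hP _ (h.mem_left k), hQ _ (h.mem_left k)] using h.startsOn k
  · rintro (_ | _ | k)
    · simpa only [Option.elim, hPc, hQc] using h2C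
    · simpa only [Option.elim, hP _ hwl, hQ _ hwl] using h3w
    · simpa only [Option.elim, hP _ (h.mem_right k), hQ _ (h.mem_right k)] using h.passesTip k
  · rintro (_ | _ | k) v (rfl | hv) hva hvw
    · exact absurd rfl hvw
    · simpa only [Option.elim, hP _ hv, hQ _ hv] using h2v v hv hva
    · exact absurd rfl hva
    · simpa only [Option.elim, hP _ hv, hQ _ hv] using h3v v hv hvw
    · simpa only [Option.elim, hPc, hQc] using (hCk k).symm
    · simpa only [Option.elim, hP _ hv, hQ _ hv] using h.crosses k v hv hva hvw
  · rintro (_ | _ | k) (_ | _ | k') hk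
    · exact absurd rfl hk
    · exact h23
    · exact h2k k'
    · exact h23.symm
    · exact absurd rfl hk
    · exact h3k k'
    · exact (h2k k).symm
    · exact (h3k k).symm
    · exact h.crosses_placeholder k k' (by rintro rfl; exact hk rfl)
  · have hnew : ∀ z, z = a l ∨ z = w l → ∃ o : Option (Option L), s(z, c) =
        s(o.elim (a l) fun o => o.elim c a, o.elim c fun o => o.elim (w l) w) := by
      rintro z (rfl | rfl)
      · exact ⟨none, rfl⟩
      · exact ⟨some none, Sym2.eq_swap⟩
    rw [Sym2.eq_iff] at hl
    rintro e (rfl | rfl | he)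
    · exact hnew x (by grind)
    · exact hnew y (by grind)
    · obtain ⟨k, hk⟩ := h.cover e he
      exact ⟨some (some k), hk⟩

theorem SimpleGraph.IsTwoTree.exists_isArrangement {V : Type*} [Finite V] {S : Set V}
    {E : Set (Sym2 V)} (hS : IsTwoTree S E) (G : SimpleGraph V)
    (hG : ∀ u ∈ S, ∀ v ∈ S, G.Adj u v → s(u, v) ∈ E) :
    ∃ (L : Type) (_ : Finite L) (P Q : V → ℝ × ℝ) (A B : L → ℝ × ℝ) (a w : L → V),
      IsArrangement G S E P Q A B a w := by
  induction hS with
  | edge hab => exact ⟨Unit, inferInstance, exists_isArrangement_edge G hab⟩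
  | @insert S E x y c hS hxy hc ih =>
    have hne : ∀ v ∈ S, v ≠ c := fun v hv hvc => hc (hvc ▸ hv)
    obtain ⟨L, _, P, Q, A, B, a, w, h⟩ := ih fun u hu v hv huv => by
      rcases hG u (.inr hu) v (.inr hv) huv with h | h | h
      · rw [Sym2.eq_iff] at h
        have := hne u hu
        have := hne v hv
        grind
      · rw [Sym2.eq_iff] at h
        have := hne u hu
        have := hne v hv
        grind
      · exact h
    refine ⟨Option (Option L), inferInstance, h.exists_insert hxy hc fun v hv hcv => ?_⟩
    rcases hG c (.inl rfl) v (.inr hv) hcv with h | h | h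
    · rw [Sym2.eq_iff] at h
      grind
    · rw [Sym2.eq_iff] at h
      grind
    · exact absurd (hS.mem_of_mem _ h c (Sym2.mem_mk_left _ _)) hc

theorem SimpleGraph.IsTwoTree.compl_isSegmentGraph {V : Type*} [Finite V] {E : Set (Sym2 V)}
    (hE : IsTwoTree Set.univ E) {G : SimpleGraph V} (hG : G.edgeSet ⊆ E) :
    Gᶜ.IsSegmentGraph := by
  obtain ⟨L, -, P, Q, A, B, a, w, h⟩ := hE.exists_isArrangement G fun u _ v _ huv => hG huv
  let e : (ℝ × ℝ) ≃ₗ[ℝ] Plane := (LinearEquiv.finTwoArrow ℝ ℝ).symm.trans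
    (WithLp.linearEquiv 2 ℝ (Fin 2 → ℝ)).symm
  have he : ∀ p q, segment ℝ (e p) (e q) = e '' segment ℝ p q := fun p q =>
    (image_segment ℝ e.toLinearMap.toAffineMap p q).symm
  refine ⟨fun v => segment ℝ (e (P v)) (e (Q v)), fun v =>
    ⟨_, _, fun hv => h.ne v trivial (e.injective hv), rfl⟩, fun u v huv => ?_⟩
  dsimp only
  rw [compl_adj, and_iff_right huv, h.adj_iff u trivial v trivial huv, not_not, he, he,
    ← Set.image_inter e.injective, Set.image_nonempty]
  rfl

/-- A graph with at most one vertex is not contained in a 2-tree, but any single segment represents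
it. -/
theorem SimpleGraph.isSegmentGraph_of_subsingleton {V : Type*} [Subsingleton V]
    (G : SimpleGraph V) : G.IsSegmentGraph := by
  obtain ⟨a, b, hab⟩ := exists_pair_ne Plane
  exact ⟨fun _ => segment ℝ a b, fun _ => ⟨a, b, hab, rfl⟩,
    fun u v huv => absurd (Subsingleton.elim u v) huv⟩

/-! ### Complements of series-parallel and outerplanar graphs -/

theorem corollary2 {V : Type*} [Finite V] (G : SimpleGraph V) :
    (G.IsSeriesParallel → Gᶜ.IsSegmentGraph) ∧ (G.IsOuterplanar → Gᶜ.IsSegmentGraph) := by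
  constructor
  · intro h
    obtain ⟨E, hE, hGE⟩ := h.exists_isTwoTree
    exact hE.compl_isSegmentGraph hGE
  · intro h
    rcases subsingleton_or_nontrivial V with _ | _
    · exact Gᶜ.isSegmentGraph_of_subsingleton
    · obtain ⟨E, hE, hGE⟩ := h.coneDrawable.exists_isTwoTree (S := Set.univ)
        (by rw [Set.ncard_univ]; exact Finite.one_lt_card) (Set.subset_univ _)
      exact hE.compl_isSegmentGraph hGE
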